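/- **Conventions.** Let $d\in\mathbb N$ and let $\mathcal W_d$ be the set of words in the letters $1,\dots,d$; $|w|$ is the length of $w$, and $X_w=X_{w_1}\cdots X_{w_n}\in\mathbb C\langle X_1,\dots,X_d\rangle$. Let $\partial_i$ be the free difference quotient, $\partial_iX_w=\sum_{w=uiv}X_u\otimes X_v$, and $D_i$ the cyclic derivative, $D_iX_w=\sum_{w=uiv}X_vX_u$ (write $D_iw$ for the corresponding formal sum of words $vu$). Given words $v_1,\dots,v_m$ and couplings $g=(g_1,\dots,g_m)\in\mathbb C^m$ put $$V=\tfrac12\sum_{i=1}^dX_i^2+W,\qquad W=\sum_{j=1}^mg_jX_{v_j}.$$ For $T>0$ let $\mathcal X$ be the set of continuous paths $\gamma:[0,T]\to\mathbb R^d$ of bounded variation with $\gamma_0=0$. For $0\le s\le t\le T$ let $S^w_{s,t}(\gamma)=\int_{s\le t_1\le\dots\le t_n\le t}d\gamma^{w_1}_{t_1}\cdots d\gamma^{w_n}_{t_n}$ be the coordinates of the signature ($S^\varnothing=1$), and let $\gamma_{s,t}$ denote the segment of $\gamma$ over $[s,t]$, regarded as an element of $\mathcal X$ by translation and affine reparametrisation.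 For $F:\mathcal X\to\mathbb C$ let $\nabla^iF(\gamma)=\lim_{h\to0}\big(F(\gamma\star h^i)-F(\gamma)\big)/h$, where $\star$ is concatenation of paths and $h^i$ is the path $t\mapsto\frac{ht}{T}e^i$; let $\nabla^w=\nabla^{w_1}\cdots\nabla^{w_n}$, extended linearly to formal sums of words, and $$\mathcal D^k_W=-\sum_{j=1}^m(-i)^{|v_j|}g_j\nabla^{D_kv_j}.$$ Coefficients $a=(a_w)_{w\in\mathcal W_d}$ in $\mathbb C$ with $|a_w|\le C^{|w|}$ for some $C>0$ define the functional $\ell(\gamma_{s,t})=\sum_{w}i^{|w|}a_wS^w_{s,t}(\gamma)$. It *satisfies the path loop equation* if for all $\gamma\in\mathcal X$ and $0\le s\le t\le T$ $$\ell(\gamma_{s,t})=1-\int_{s\le u\le r\le t}\ell(\gamma_{s,u})\,\ell(\gamma_{u,r})\,\langle d\gamma_u,d\gamma_r\rangle-\sum_{k=1}^d\int_s^t\mathcal D_W^k\ell(\gamma_{s,u})\,d\gamma^k_u .$$ **Proposition.** Let $v_1,\dots,v_m\in\mathcal W_d$, $R>2$ and $C>0$. There is $\varepsilon>0$ such that for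 all $g\in\mathbb C^m$ with $\max_j|g_j|\le\varepsilon$ the following holds. 1. There is exactly one linear functional $\tau_V:\mathbb C\langle X_1,\dots,X_d\rangle\to\mathbb C$ with $\tau_V(1)=1$ and $|\tau_V(X_w)|\le R^{|w|}$ for all words $w$ that solves the Schwinger–Dyson equation $$(\tau_V\otimes\tau_V)(\partial_iP)=\tau_V(P\,D_iV)\qquad\text{for all }P\in\mathbb C\langle X_1,\dots,X_d\rangle,\ 1\le i\le d.$$ (In particular, any non-commutative law with this bound that solves this equation is $\tau_V$.) 2. For every $T>0$: the functional with coefficients $a_w=\tau_V(X_w)$ satisfies the path loop equation; and if $\ell$ is a functional with coefficients $|a_w|\le C^{|w|}$ for all $w$ that satisfies the path loop equation, then $a_w=\tau_V(X_w)$ for all words $w$. -/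

import Mathlib

open MeasureTheory Filter Set Topology
open scoped TensorProduct

noncomputable section

namespace PathLoop

/-! ### Words, non-commutative polynomials, free difference quotients, cyclic derivatives

Words in the letters `Fin d` are lists; `w ++ u` is concatenation and `w.length` is `|w|`. -/

/-- Non-commutative polynomials `ℂ⟨X_1, …, X_d⟩`. -/
abbrev NCPoly (d : ℕ) : Type := FreeAlgebra ℂ (Fin d)

/-- The monomial `X_w = X_{w_1} ⋯ X_{w_n}` of a word `w = w_1 ⋯ w_n`. -/
def mono {d : ℕ} (w : List (Fin d)) : NCPoly d := (w.map (FreeAlgebra.ι ℂ)).prod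

/-- All decompositions `w = u i v`, listed as the pairs `(u, v)`. -/
def splits {d : ℕ} (i : Fin d) : List (Fin d) → List (List (Fin d) × List (Fin d))
  | [] => []
  | k :: w => (if k = i then [([], w)] else []) ++ (splits i w).map (fun p => (k :: p.1, p.2))

theorem mem_splits {d : ℕ} (i : Fin d) (w : List (Fin d)) (p : List (Fin d) × List (Fin d)) :
    p ∈ splits i w ↔ w = p.1 ++ i :: p.2 := by
  induction w generalizing p with
  | nil => simp [splits]
  | cons k w ih =>
    obtain ⟨x, y⟩ := p
    simp only [splits, List.mem_append, List.mem_map, ih]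
    constructor
    · rintro (h | ⟨⟨x', y'⟩, h, h2⟩)
      · split_ifs at h with hk
        · simp at h
          simp [h.1, h.2, hk]
        · simp at h
      · simp only [Prod.mk.injEq] at h2
        obtain ⟨rfl, rfl⟩ := h2
        simp [h]
    · intro h
      cases x with
      | nil =>
        simp at h
        left
        simp [h.1, h.2]
      | cons a x =>
        simp at h
        right
        exact ⟨(x, y), h.2, by simp [h.1]⟩

theorem splits_append {d : ℕ} (i : Fin d) (w u : List (Fin d)) :
    splits i (w ++ u) = (splits i w).map (fun p => (p.1, p.2 ++ u)) ++
      (splits i u).map (fun p => (w ++ p.1, p.2)) := by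
  induction w with
  | nil => simp [splits]
  | cons k w ih =>
    simp only [List.cons_append, splits, ih, List.map_append, List.map_map, List.append_assoc]
    split_ifs <;> simp [Function.comp_def]

/-- The free difference quotient `∂_i`, the linear map with
`∂_i X_w = ∑_{w = u i v} X_u ⊗ X_v`. -/
def freeDiff {d : ℕ} (i : Fin d) : NCPoly d →ₗ[ℂ] NCPoly d ⊗[ℂ] NCPoly d :=
  (FreeAlgebra.basisFreeMonoid ℂ (Fin d)).constr ℂ
    (fun w => ((splits i (FreeMonoid.toList w)).map (fun p => mono p.1 ⊗ₜ[ℂ] mono p.2)).sum)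

theorem mono_append {d : ℕ} (u w : List (Fin d)) : mono (u ++ w) = mono u * mono w := by
  simp [mono]

theorem mono_eq_basis {d : ℕ} (w : List (Fin d)) :
    mono w = FreeAlgebra.basisFreeMonoid ℂ (Fin d) (FreeMonoid.ofList w) := by
  induction w with
  | nil =>
    simp [mono, FreeAlgebra.basisFreeMonoid, FreeAlgebra.equivMonoidAlgebraFreeMonoid,
      MonoidAlgebra.lift_single]
  | cons k w ih =>
    rw [← List.singleton_append, mono_append, ih]
    simp [mono, FreeAlgebra.basisFreeMonoid, FreeAlgebra.equivMonoidAlgebraFreeMonoid,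
      MonoidAlgebra.lift_single]

theorem freeDiff_mono {d : ℕ} (i : Fin d) (w : List (Fin d)) :
    freeDiff i (mono w) = ((splits i w).map (fun p => mono p.1 ⊗ₜ[ℂ] mono p.2)).sum := by
  rw [mono_eq_basis, freeDiff, Module.Basis.constr_basis]
  simp

/-- `∂_i X_j = δ_{ij} 1 ⊗ 1`. -/
theorem freeDiff_ι {d : ℕ} (i j : Fin d) :
    freeDiff i (FreeAlgebra.ι ℂ j) = if i = j then 1 ⊗ₜ[ℂ] 1 else 0 := by
  have h := freeDiff_mono i [j]
  simp only [mono, List.map_cons, List.map_nil, List.prod_cons, List.prod_nil, mul_one] at h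
  rw [h]
  by_cases hij : i = j
  · simp [splits, hij]
  · simp [splits, hij, Ne.symm hij]

/-- The Leibniz rule `∂_i(PQ) = ∂_iP × (1 ⊗ Q) + (P ⊗ 1) × ∂_iQ`. -/
theorem freeDiff_mul {d : ℕ} (i : Fin d) (P Q : NCPoly d) :
    freeDiff i (P * Q) = freeDiff i P * (1 ⊗ₜ[ℂ] Q) + (P ⊗ₜ[ℂ] 1) * freeDiff i Q := by
  have key : (LinearMap.mul ℂ (NCPoly d)).compr₂ (freeDiff i) =
      (LinearMap.mul ℂ (NCPoly d ⊗[ℂ] NCPoly d)).compl₁₂ (freeDiff i)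
        (TensorProduct.mk ℂ (NCPoly d) (NCPoly d) 1) +
      (LinearMap.mul ℂ (NCPoly d ⊗[ℂ] NCPoly d)).compl₁₂
        ((TensorProduct.mk ℂ (NCPoly d) (NCPoly d)).flip 1) (freeDiff i) := by
    refine (FreeAlgebra.basisFreeMonoid ℂ (Fin d)).ext fun u => ?_
    refine (FreeAlgebra.basisFreeMonoid ℂ (Fin d)).ext fun w => ?_
    have hu := mono_eq_basis (FreeMonoid.toList u)
    have hw := mono_eq_basis (FreeMonoid.toList w)
    simp only [FreeMonoid.ofList_toList] at hu hw
    rw [← hu, ← hw]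
    simp only [LinearMap.compr₂_apply, LinearMap.mul_apply', LinearMap.add_apply,
      LinearMap.compl₁₂_apply, TensorProduct.mk_apply, LinearMap.flip_apply]
    rw [← mono_append, freeDiff_mono, freeDiff_mono, freeDiff_mono, splits_append,
      List.map_append, List.sum_append, ← List.sum_map_mul_right, ← List.sum_map_mul_left]
    simp [Function.comp_def, mono_append]
  have := congrArg (fun f => f P Q) key
  simpa using this

/-- The cyclic derivative `D_i = 𝔪 ∘ ∂_i` with `𝔪(P ⊗ Q) = Q P`, so that
`D_i X_w = ∑_{w = u i v} X_v X_u`. -/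
def cyclicDiff {d : ℕ} (i : Fin d) : NCPoly d →ₗ[ℂ] NCPoly d :=
  (LinearMap.mul' ℂ (NCPoly d) ∘ₗ (TensorProduct.comm ℂ (NCPoly d) (NCPoly d)).toLinearMap) ∘ₗ
    freeDiff i

/-- The cyclic derivative at the level of words: the list of the words in
`D_i w = ∑_{w = u i v} v u`, with repetitions. -/
def cyclicWords {d : ℕ} (i : Fin d) (w : List (Fin d)) : List (List (Fin d)) :=
  (splits i w).map (fun p => p.2 ++ p.1)

theorem cyclicDiff_mono {d : ℕ} (i : Fin d) (w : List (Fin d)) :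
    cyclicDiff i (mono w) = ((cyclicWords i w).map mono).sum := by
  simp [cyclicDiff, freeDiff_mono, cyclicWords, map_list_sum, Function.comp_def, mono_append]

/-- The potential `V = ½ ∑_i X_i² + ∑_j g_j X_{v_j}`. -/
def potential {d m : ℕ} (v : Fin m → List (Fin d)) (g : Fin m → ℂ) : NCPoly d :=
  (1 / 2 : ℂ) • ∑ i : Fin d, FreeAlgebra.ι ℂ i ^ 2 + ∑ j : Fin m, g j • mono (v j)

/-- `τ ⊗ τ`, the linear functional with `(τ ⊗ τ)(P ⊗ Q) = τ(P) τ(Q)`. -/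
def tensorSq {d : ℕ} (τ : NCPoly d →ₗ[ℂ] ℂ) : NCPoly d ⊗[ℂ] NCPoly d →ₗ[ℂ] ℂ :=
  LinearMap.mul' ℂ ℂ ∘ₗ TensorProduct.map τ τ

/-- `τ` is a normalised linear functional on `ℂ⟨X_1, …, X_d⟩` that solves the Schwinger-Dyson
equation with potential `V` and satisfies `|τ(X_w)| ≤ R^{|w|}`. -/
structure IsSchwingerDysonSolution {d : ℕ} (V : NCPoly d) (R : ℝ) (τ : NCPoly d →ₗ[ℂ] ℂ) :
    Prop where
  map_one : τ 1 = 1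
  schwinger_dyson : ∀ (i : Fin d) (P : NCPoly d),
    tensorSq τ (freeDiff i P) = τ (P * cyclicDiff i V)
  bound : ∀ w : List (Fin d), ‖τ (mono w)‖ ≤ R ^ w.length

/-! ### Paths of bounded variation -/

theorem boundedVariationOn_add {E : Type*} [SeminormedAddCommGroup E] {f g : ℝ → E} {s : Set ℝ}
    (hf : BoundedVariationOn f s) (hg : BoundedVariationOn g s) :
    BoundedVariationOn (fun t => f t + g t) s := by
  have h : eVariationOn (fun t => f t + g t) s ≤ eVariationOn f s + eVariationOn g s := by
    refine iSup_le fun p => ?_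
    calc ∑ i ∈ Finset.range p.1, edist (f (p.2.1 (i + 1)) + g (p.2.1 (i + 1)))
          (f (p.2.1 i) + g (p.2.1 i))
        ≤ ∑ i ∈ Finset.range p.1, (edist (f (p.2.1 (i + 1))) (f (p.2.1 i)) +
            edist (g (p.2.1 (i + 1))) (g (p.2.1 i))) :=
          Finset.sum_le_sum fun i _ => edist_add_add_le _ _ _ _
      _ ≤ _ := by
          rw [Finset.sum_add_distrib]
          exact add_le_add (eVariationOn.sum_le p.2.2.1 p.2.2.2)
            (eVariationOn.sum_le p.2.2.1 p.2.2.2)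
  exact ne_top_of_le_ne_top (ENNReal.add_ne_top.2 ⟨hf, hg⟩) h

/-- The space of continuous paths `γ : [0, T] → ℝ^d` of bounded variation with `γ_0 = 0`. A path on
`[0, T]` is represented by its extension to `ℝ` that is constant on `(-∞, 0]` and on `[T, ∞)`. -/
@[ext]
structure BVPath (d : ℕ) (T : ℝ) where
  toFun : ℝ → EuclideanSpace ℝ (Fin d)
  continuous_toFun : Continuous toFun
  boundedVariation : BoundedVariationOn toFun univ
  eq_zero : ∀ t, t ≤ 0 → toFun t = 0
  eq_end : ∀ t, T ≤ t → toFun t = toFun T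

namespace BVPath

variable {d : ℕ} {T : ℝ}

theorem boundedVariation_coord (γ : BVPath d T) (k : Fin d) :
    BoundedVariationOn (fun t => γ.toFun t k) univ :=
  (EuclideanSpace.proj (𝕜 := ℝ) k).lipschitz.comp_boundedVariationOn γ.boundedVariation

/-- The Stieltjes measure `dγ^k` of the `k`-th coordinate of `γ`. -/
def coordMeasure (γ : BVPath d T) (k : Fin d) : SignedMeasure ℝ :=
  (γ.boundedVariation_coord k).vectorMeasure

/-- The Stieltjes integral `∫_s^t f(u) dγ_u^k` of a real or complex valued function. -/
def integral {E : Type*} [NormedAddCommGroup E] [NormedSpace ℝ E] (γ : BVPath d T) (k : Fin d)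
    (s t : ℝ) (f : ℝ → E) : E :=
  ∫ᵛ u in Ioc s t, f u ∂<•(γ.coordMeasure k)

/-- Iterated integrals, for a word given in reverse order (last letter first). -/
def sigRev (γ : BVPath d T) (s : ℝ) : List (Fin d) → ℝ → ℝ
  | [], _ => 1
  | k :: w, t => γ.integral k s t (fun u => sigRev γ s w u)

/-- The coordinate iterated integral
`S^w_{s,t}(γ) = ∫_{s ≤ t_1 ≤ ⋯ ≤ t_n ≤ t} dγ^{w_1}_{t_1} ⋯ dγ^{w_n}_{t_n}`, that is
`S^∅_{s,t}(γ) = 1` and `S^{wk}_{s,t}(γ) = ∫_s^t S^w_{s,u}(γ) dγ_u^k`. -/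
def sig (γ : BVPath d T) (w : List (Fin d)) (s t : ℝ) : ℝ := γ.sigRev s w.reverse t

theorem sig_nil (γ : BVPath d T) (s t : ℝ) : γ.sig [] s t = 1 := rfl

theorem sig_append_singleton (γ : BVPath d T) (w : List (Fin d)) (k : Fin d) (s t : ℝ) :
    γ.sig (w ++ [k]) s t = γ.integral k s t (fun u => γ.sig w s u) := by
  simp [sig, sigRev]

/-- The concatenation `γ ⋆ σ`; see `concat_of_le` and `concat_of_ge`. -/
def concat [hT : Fact (0 < T)] (γ σ : BVPath d T) : BVPath d T where
  toFun t := γ.toFun (2 * t) + σ.toFun (2 * (t - T / 2))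
  continuous_toFun := (γ.continuous_toFun.comp (by fun_prop)).add
    (σ.continuous_toFun.comp (by fun_prop))
  boundedVariation := by
    refine boundedVariationOn_add (f := γ.toFun ∘ fun t => 2 * t)
      (g := σ.toFun ∘ fun t => 2 * (t - T / 2)) ?_ ?_
    · refine ne_top_of_le_ne_top γ.boundedVariation (eVariationOn.comp_le_of_monotoneOn _ _ ?_ ?_)
      · intro a _ b _ h
        dsimp only
        linarith
      · exact mapsTo_univ _ _
    · refine ne_top_of_le_ne_top σ.boundedVariation (eVariationOn.comp_le_of_monotoneOn _ _ ?_ ?_)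
      · intro a _ b _ h
        dsimp only
        linarith
      · exact mapsTo_univ _ _
  eq_zero t ht := by
    have := hT.out
    rw [γ.eq_zero _ (by linarith), σ.eq_zero _ (by linarith), add_zero]
  eq_end t ht := by
    have := hT.out
    rw [γ.eq_end _ (by linarith), σ.eq_end _ (by linarith), γ.eq_end (2 * T) (by linarith)]
    congr 2
    ring

theorem concat_of_le [Fact (0 < T)] (γ σ : BVPath d T) {t : ℝ} (ht : t ≤ T / 2) :
    (γ.concat σ).toFun t = γ.toFun (2 * t) := by
  simp [concat, σ.eq_zero (2 * (t - T / 2)) (by linarith)]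

theorem concat_of_ge [Fact (0 < T)] (γ σ : BVPath d T) {t : ℝ} (ht : T / 2 ≤ t) :
    (γ.concat σ).toFun t = γ.toFun T + σ.toFun (2 * (t - T / 2)) := by
  simp [concat, γ.eq_end (2 * t) (by linarith)]

/-- The map that is the identity on `[0, T]`, `0` on `(-∞, 0]` and `T` on `[T, ∞)`. -/
def clamp (T t : ℝ) : ℝ := max 0 (min T t)

/-- The straight path `h^i : t ↦ (h t / T) e^i` on `[0, T]`. -/
def line [hT : Fact (0 < T)] (i : Fin d) (h : ℝ) : BVPath d T where
  toFun t := (h * clamp T t / T) • EuclideanSpace.single i (1 : ℝ)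
  continuous_toFun := by
    unfold clamp
    fun_prop
  boundedVariation := by
    have h1 : BoundedVariationOn (clamp T) univ := by
      have hm : MonotoneOn (clamp T) univ := fun a _ b _ hab =>
        max_le_max le_rfl (min_le_min le_rfl hab)
      refine hm.boundedVariationOn (C := T) fun x _ => ?_
      have h0 : (0 : ℝ) ≤ clamp T x := le_max_left _ _
      rw [abs_of_nonneg h0]
      exact max_le hT.out.le (min_le_left _ _)
    have h2 : LipschitzWith _ ((ContinuousLinearMap.id ℝ ℝ).smulRight
        ((h / T) • EuclideanSpace.single i (1 : ℝ))) := ContinuousLinearMap.lipschitz _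
    convert! h2.comp_boundedVariationOn h1 using 2 with t
    simp only [Function.comp_apply, ContinuousLinearMap.smulRight_apply,
      ContinuousLinearMap.id_apply, smul_smul]
    congr 1
    ring
  eq_zero t ht := by
    simp [clamp, min_le_of_right_le ht]
  eq_end t ht := by
    simp [clamp, ht]

/-- The segment `γ_{s,u}` of `γ`, regarded as a path on `[0, T]` that starts at `0`:
`r ↦ γ_{s + (u - s) r / T} - γ_s`. -/
def segment [hT : Fact (0 < T)] (γ : BVPath d T) (s u : ℝ) : BVPath d T where
  toFun r := γ.toFun (s + (u - s) * (clamp T r / T)) + -γ.toFun s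
  continuous_toFun := by
    refine (γ.continuous_toFun.comp ?_).add continuous_const
    unfold clamp
    fun_prop
  boundedVariation := by
    have hm : Monotone (clamp T) := fun a b hab => max_le_max le_rfl (min_le_min le_rfl hab)
    have hm2 : Monotone fun r => clamp T r / T := fun a b hab =>
      div_le_div_of_nonneg_right (hm hab) hT.out.le
    refine boundedVariationOn_add (f := γ.toFun ∘ fun r => s + (u - s) * (clamp T r / T))
      (g := fun _ => -γ.toFun s) ?_ ?_
    · refine ne_top_of_le_ne_top γ.boundedVariation ?_
      rcases le_total s u with hsu | hsu
      · refine eVariationOn.comp_le_of_monotoneOn _ _ (fun a _ b _ hab => ?_) (mapsTo_univ _ _)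
        have := mul_le_mul_of_nonneg_left (hm2 hab) (sub_nonneg.2 hsu)
        dsimp only at this ⊢
        linarith
      · refine eVariationOn.comp_le_of_antitoneOn _ _ (fun a _ b _ hab => ?_) (mapsTo_univ _ _)
        have := mul_le_mul_of_nonneg_left (hm2 hab) (sub_nonneg.2 hsu)
        dsimp only at this ⊢
        linarith
    · unfold BoundedVariationOn
      rw [eVariationOn.constant_on]
      · simp
      · rintro _ ⟨a, _, rfl⟩ _ ⟨b, _, rfl⟩
        rfl
  eq_zero t ht := by
    simp [clamp, min_le_of_right_le ht]
  eq_end t ht := by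
    simp [clamp, ht]

theorem segment_of_mem [hT : Fact (0 < T)] (γ : BVPath d T) (s u : ℝ) {r : ℝ}
    (hr : r ∈ Icc 0 T) :
    (γ.segment s u).toFun r = γ.toFun (s + (u - s) * (r / T)) - γ.toFun s := by
  simp [segment, clamp, hr.1, hr.2, sub_eq_add_neg]

end BVPath

/-! ### Functionals on path space and the path loop equation -/

variable {d : ℕ} {T : ℝ}

/-- The vertical derivative `∇^i F(γ) = lim_{h → 0} (F(γ ⋆ h^i) - F(γ)) / h`. -/
def verticalDeriv [Fact (0 < T)] (i : Fin d) (F : BVPath d T → ℂ) (γ : BVPath d T) : ℂ :=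
  limUnder (𝓝[≠] (0 : ℝ)) (fun h : ℝ => (F (γ.concat (BVPath.line i h)) - F γ) / (h : ℂ))

/-- `∇^w = ∇^{w_1} ⋯ ∇^{w_k}`. -/
def verticalDerivWord [Fact (0 < T)] (w : List (Fin d)) (F : BVPath d T → ℂ) : BVPath d T → ℂ :=
  w.foldr verticalDeriv F

/-- The operator `𝒟_W^k = - ∑_j (-i)^{|v_j|} g_j ∇^{D_k v_j}` of `W = ∑_j g_j X_{v_j}`. -/
def loopOperator [Fact (0 < T)] {m : ℕ} (v : Fin m → List (Fin d)) (g : Fin m → ℂ) (k : Fin d)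
    (F : BVPath d T → ℂ) (γ : BVPath d T) : ℂ :=
  -∑ j : Fin m, (-Complex.I) ^ (v j).length * g j *
    ((cyclicWords k (v j)).map (fun w => verticalDerivWord w F γ)).sum

/-- The infinite linear functional of the signature
`ℓ(γ_{s,t}) = ∑_w i^{|w|} a_w S^w_{s,t}(γ)`. -/
def sigFunctional (a : List (Fin d) → ℂ) (γ : BVPath d T) (s t : ℝ) : ℂ :=
  ∑' w : List (Fin d), Complex.I ^ w.length * a w * (γ.sig w s t : ℂ)

/-- The functional `ℓ` with coefficients `a` satisfies the path loop equation of
`W = ∑_j g_j X_{v_j}`: for every path `γ` on `[0, T]` and all `0 ≤ s ≤ t ≤ T`,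
`ℓ(γ_{s,t}) = 1 - ∫_{s ≤ u ≤ r ≤ t} ℓ(γ_{s,u}) ℓ(γ_{u,r}) ⟨dγ_u, dγ_r⟩
  - ∑_k ∫_s^t 𝒟_W^k ℓ(γ_{s,u}) dγ_u^k`. -/
def SatisfiesLoopEquation (T : ℝ) [Fact (0 < T)] {m : ℕ} (v : Fin m → List (Fin d))
    (g : Fin m → ℂ) (a : List (Fin d) → ℂ) : Prop :=
  ∀ (γ : BVPath d T) (s t : ℝ), 0 ≤ s → s ≤ t → t ≤ T →
    sigFunctional a γ s t = 1
      - ∑ k : Fin d, γ.integral k s t (fun r => γ.integral k s r (fun u =>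
          sigFunctional a γ s u * sigFunctional a γ u r))
      - ∑ k : Fin d, γ.integral k s t (fun u =>
          loopOperator v g k (fun η : BVPath d T => sigFunctional a η 0 T) (γ.segment s u))

end PathLoop

end

noncomputable section

namespace PathLoop

/-! ### Densities of signed measures -/

/-! Both equations are the same fixed point equation `sdMap v g a = a` for coefficients on words.
When the Schwinger-Dyson equation is tested on P = X_w, the quadratic part of V contributes τ(X_w
X_k). The equation thus expresses the moment of wk as the sum of a_p a_q over w = pkq, minus the sum
of g_j a_{wz} over j and the words z of D_k v_j (`isSchwingerDysonSolution_iff`).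

The loop equation produces the same map. Integrating S^p_{s,u} S^q_{u,r} against dγ^k_u gives
S^{pkq}_{s,r} (`integral_sigRev_mul_sigRev`), the outer integral appends another k, and ∇^z shifts
coefficients from c_w to c_{wz} (`verticalDerivWord_pathSeries`). The powers of i combine into one
factor, so the right-hand side is the signature functional with coefficients `sdMap v g a`
(`loop_rhs_eq_sigFunctional`). Factorial decay of iterated integrals (`abs_sigRev_le`) against
exponential growth of coefficients justifies all termwise operations. Vertical derivatives at the
zero path recover the coefficients (`eq_of_pathSeries_eq`), which gives `satisfiesLoopEquation_iff`.

To solve the fixed point equation, weight the largest coefficient of length n by r^n and sum over n.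
The quadratic part is then dominated by r² times a Cauchy product, and the linear part is of the
order of the couplings (`weightedNorm_sdMap_sub_le`). If 4r² < 1 and the couplings are small, the
map contracts the ball of radius 2. The weight r = 1/R gives existence; since the empty word uses up
half of the radius, the bound R^{|w|} comes out without a constant. Uniqueness among coefficients of
growth M = max(R, C) uses r = 1/(2M), for which they all lie in that ball. -/

theorem isFiniteMeasure_variation {X : Type*} [MeasurableSpace X] (ν : SignedMeasure X) :
    IsFiniteMeasure ν.variation := by
  rw [← SignedMeasure.totalVariation_eq_variation]
  infer_instance

/-- The density is 1 on a positive set of a Hahn decomposition and -1 off it. It turns integrals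
against a signed measure into Bochner integrals against a finite positive one, where dominated
convergence and Fubini apply. -/
theorem exists_sign_density {X : Type*} [MeasurableSpace X] (ν : SignedMeasure X) :
    ∃ h : X → ℝ, Measurable h ∧ (∀ x, |h x| = 1) ∧
      ∀ (E : Type) [NormedAddCommGroup E] [NormedSpace ℝ E] (f : X → E) (s : Set X),
        MeasurableSet s →
          ∫ᵛ u in s, f u ∂<•ν = ∫ u in s, h u • f u ∂ν.variation := by
  classical
  obtain ⟨i, hi, hi₂, hi₃, hP, hN⟩ := ν.toJordanDecomposition_spec
  set P := ν.toJordanDecomposition.posPart with hPdef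
  set N := ν.toJordanDecomposition.negPart with hNdef
  have hm : ν.variation = P + N := by
    rw [← SignedMeasure.totalVariation_eq_variation]; rfl
  have hν : ν = P.toSignedMeasure - N.toSignedMeasure :=
    (SignedMeasure.toSignedMeasure_toJordanDecomposition ν).symm
  have hPi : P iᶜ = 0 := by
    rw [hP, SignedMeasure.toMeasureOfZeroLE_apply _ _ _ hi.compl]
    simp
  have hNi : N i = 0 := by
    rw [hN, SignedMeasure.toMeasureOfLEZero_apply _ _ _ hi]
    simp
  have hPr : ν.variation.restrict i = P := by
    rw [hm, Measure.restrict_add, Measure.restrict_eq_zero.2 hNi, add_zero]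
    exact Measure.restrict_eq_self_of_ae_mem (by rw [ae_iff]; exact hPi)
  have hNr : ν.variation.restrict iᶜ = N := by
    rw [hm, Measure.restrict_add, Measure.restrict_eq_zero.2 hPi, zero_add]
    refine Measure.restrict_eq_self_of_ae_mem ?_
    rw [ae_iff]
    simpa using hNi
  refine ⟨fun x => if x ∈ i then 1 else -1, Measurable.ite hi measurable_const measurable_const,
    fun x => by by_cases hx : x ∈ i <;> simp [hx], ?_⟩
  intro E _ _ f s hs
  rw [← VectorMeasure.integral_indicator hs, ← integral_indicator hs]
  set g := s.indicator f
  have hsg : s.indicator (fun u => (if u ∈ i then (1 : ℝ) else -1) • f u) =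
      fun u => (if u ∈ i then (1 : ℝ) else -1) • g u := by
    ext u
    by_cases hu : u ∈ s <;> simp [g, hu]
  rw [hsg]
  have hmeas : Measurable fun u => if u ∈ i then (1 : ℝ) else -1 :=
    Measurable.ite hi measurable_const measurable_const
  by_cases hg : Integrable g ν.variation
  · have hgP : Integrable g P := hg.mono_measure (by rw [hm]; exact Measure.le_add_right le_rfl)
    have hgN : Integrable g N := hg.mono_measure (by rw [hm]; exact Measure.le_add_left le_rfl)
    have hint : Integrable (fun u => (if u ∈ i then (1 : ℝ) else -1) • g u) ν.variation := by
      refine hg.bdd_smul 1 hmeas.aestronglyMeasurable (Eventually.of_forall fun x => ?_)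
      by_cases hx : x ∈ i <;> simp [hx]
    rw [← integral_add_compl hi hint]
    have e1 : ∫ u in i, (if u ∈ i then (1 : ℝ) else -1) • g u ∂ν.variation = ∫ u, g u ∂P := by
      rw [← hPr]
      exact setIntegral_congr_fun hi fun u hu => by simp [hu]
    have e2 : ∫ u in iᶜ, (if u ∈ i then (1 : ℝ) else -1) • g u ∂ν.variation =
        -∫ u, g u ∂N := by
      rw [← hNr, ← integral_neg]
      exact setIntegral_congr_fun hi.compl fun u hu => by simp [show u ∉ i from hu]
    rw [e1, e2]
    conv_lhs => rw [hν]
    rw [VectorMeasure.integral_sub_vectorMeasure]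
    · simp [sub_eq_add_neg]
    · simpa [VectorMeasure.Integrable] using hgP
    · simpa [VectorMeasure.Integrable] using hgN
  -- Without integrability both sides have the default value 0: multiplying by the sign twice gives
  -- back g, so neither integrand is integrable.
  · rw [VectorMeasure.integral_undef hg, integral_undef]
    intro h
    apply hg
    have h2 := h.bdd_smul (φ := fun u => if u ∈ i then (1 : ℝ) else -1) 1
      hmeas.aestronglyMeasurable (Eventually.of_forall fun x => by
        by_cases hx : x ∈ i <;> simp [hx])
    refine h2.congr (Eventually.of_forall fun x => ?_)
    by_cases hx : x ∈ i <;> simp [hx]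

/-! ### Stieltjes integration along a path -/

namespace BVPath

variable {d : ℕ} {T : ℝ}

/-- The total variation measure of the `k`-th coordinate of a path. -/
def varMeasure (γ : BVPath d T) (k : Fin d) : Measure ℝ := (γ.coordMeasure k).variation

instance (γ : BVPath d T) (k : Fin d) : IsFiniteMeasure (γ.varMeasure k) :=
  isFiniteMeasure_variation _

theorem continuous_coord (γ : BVPath d T) (k : Fin d) : Continuous fun t => γ.toFun t k :=
  (EuclideanSpace.proj (𝕜 := ℝ) k).continuous.comp γ.continuous_toFun

theorem coordMeasure_Ioc (γ : BVPath d T) (k : Fin d) {a b : ℝ} (h : a ≤ b) :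
    γ.coordMeasure k (Ioc a b) = γ.toFun b k - γ.toFun a k := by
  rw [coordMeasure, BoundedVariationOn.vectorMeasure_Ioc _ h,
    (γ.continuous_coord k).continuousWithinAt.rightLim_eq,
    (γ.continuous_coord k).continuousWithinAt.rightLim_eq]

/-- The mass of a point is a jump of the path, and paths are continuous. Hence endpoints and
diagonals are negligible. -/
instance (γ : BVPath d T) (k : Fin d) : NullSingletonClass (γ.varMeasure k) where
  measure_singleton a := by
    rw [varMeasure, VectorMeasure.variation_apply_eq_zero (measurableSet_singleton a)]
    intro t ht _
    rcases Set.subset_singleton_iff_eq.1 ht with rfl | rfl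
    · simp
    · rw [coordMeasure, BoundedVariationOn.vectorMeasure_singleton,
        (γ.continuous_coord k).continuousWithinAt.rightLim_eq,
        (γ.continuous_coord k).continuousWithinAt.leftLim_eq, sub_self]

/-- The density of `dγ^k` with respect to its total variation. -/
def sgn (γ : BVPath d T) (k : Fin d) : ℝ → ℝ := (exists_sign_density (γ.coordMeasure k)).choose

theorem measurable_sgn (γ : BVPath d T) (k : Fin d) : Measurable (γ.sgn k) :=
  (exists_sign_density (γ.coordMeasure k)).choose_spec.1

theorem abs_sgn (γ : BVPath d T) (k : Fin d) (x : ℝ) : |γ.sgn k x| = 1 :=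
  (exists_sign_density (γ.coordMeasure k)).choose_spec.2.1 x

variable {E : Type} [NormedAddCommGroup E] [NormedSpace ℝ E]

theorem integral_eq (γ : BVPath d T) (k : Fin d) (s t : ℝ) (f : ℝ → E) :
    γ.integral k s t f = ∫ u in Ioc s t, γ.sgn k u • f u ∂γ.varMeasure k :=
  (exists_sign_density (γ.coordMeasure k)).choose_spec.2.2 E f _ measurableSet_Ioc

theorem integral_congr (γ : BVPath d T) (k : Fin d) {s t : ℝ} {f g : ℝ → E}
    (h : ∀ u ∈ Ioc s t, f u = g u) : γ.integral k s t f = γ.integral k s t g := by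
  rw [integral_eq, integral_eq]
  exact setIntegral_congr_fun measurableSet_Ioc fun u hu => by simp only [h u hu]

theorem integral_of_ge (γ : BVPath d T) (k : Fin d) {s t : ℝ} (h : t ≤ s) (f : ℝ → E) :
    γ.integral k s t f = 0 := by
  rw [integral_eq, Ioc_eq_empty (not_lt.2 h)]
  simp

theorem integral_smul_left (γ : BVPath d T) (k : Fin d) (s t : ℝ) (c : ℝ) (f : ℝ → E) :
    γ.integral k s t (fun u => c • f u) = c • γ.integral k s t f := by
  rw [integral_eq, integral_eq, ← integral_smul]
  simp only [smul_comm c]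

theorem integral_const_mul (γ : BVPath d T) (k : Fin d) (s t : ℝ) (c : ℂ) (f : ℝ → ℂ) :
    γ.integral k s t (fun u => c * f u) = c * γ.integral k s t f := by
  rw [integral_eq, integral_eq, ← MeasureTheory.integral_const_mul]
  simp only [mul_smul_comm]

theorem integral_mul_const (γ : BVPath d T) (k : Fin d) (s t : ℝ) (c : ℝ) (f : ℝ → ℝ) :
    γ.integral k s t (fun u => f u * c) = γ.integral k s t f * c := by
  simpa [mul_comm] using γ.integral_smul_left k s t c f

theorem integral_ofReal (γ : BVPath d T) (k : Fin d) (s t : ℝ) (f : ℝ → ℝ) :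
    γ.integral k s t (fun u => (f u : ℂ)) = ((γ.integral k s t f : ℝ) : ℂ) := by
  rw [integral_eq, integral_eq, ← integral_complex_ofReal]
  simp

theorem integrable_sgn_smul (γ : BVPath d T) (k : Fin d) {s t : ℝ} {f : ℝ → E}
    (hf : IntegrableOn f (Ioc s t) (γ.varMeasure k)) :
    IntegrableOn (fun u => γ.sgn k u • f u) (Ioc s t) (γ.varMeasure k) :=
  hf.bdd_smul 1 (γ.measurable_sgn k).aestronglyMeasurable
    (Eventually.of_forall fun x => (γ.abs_sgn k x).le)

theorem integral_const (γ : BVPath d T) (k : Fin d) {s t : ℝ} (h : s ≤ t) (c : ℝ) :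
    γ.integral k s t (fun _ => c) = c * (γ.toFun t k - γ.toFun s k) := by
  have : IsFiniteMeasure (γ.coordMeasure k).variation := isFiniteMeasure_variation _
  rw [integral, VectorMeasure.setIntegral_const, coordMeasure_Ioc _ _ h]
  simp [mul_comm]

theorem integral_add_adjacent (γ : BVPath d T) (k : Fin d) {s u t : ℝ} (hsu : s ≤ u)
    (hut : u ≤ t) {f : ℝ → E} (hf : IntegrableOn f (Ioc s t) (γ.varMeasure k)) :
    γ.integral k s u f + γ.integral k u t f = γ.integral k s t f := by
  have h := γ.integrable_sgn_smul k hf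
  rw [integral_eq, integral_eq, integral_eq, ← Ioc_union_Ioc_eq_Ioc hsu hut,
    setIntegral_union (Ioc_disjoint_Ioc_of_le le_rfl) measurableSet_Ioc
      (h.mono_set (Ioc_subset_Ioc_right hut)) (h.mono_set (Ioc_subset_Ioc_left hsu))]

theorem integral_sub (γ : BVPath d T) (k : Fin d) {s t : ℝ} {f g : ℝ → E}
    (hf : IntegrableOn f (Ioc s t) (γ.varMeasure k))
    (hg : IntegrableOn g (Ioc s t) (γ.varMeasure k)) :
    γ.integral k s t (fun u => f u - g u) = γ.integral k s t f - γ.integral k s t g := by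
  rw [integral_eq, integral_eq, integral_eq,
    ← MeasureTheory.integral_sub (γ.integrable_sgn_smul k hf) (γ.integrable_sgn_smul k hg)]
  simp only [smul_sub]

theorem integral_finset_sum (γ : BVPath d T) (k : Fin d) {s t : ℝ} {ι : Type*} (S : Finset ι)
    {f : ι → ℝ → E} (hf : ∀ i ∈ S, IntegrableOn (f i) (Ioc s t) (γ.varMeasure k)) :
    γ.integral k s t (fun u => ∑ i ∈ S, f i u) = ∑ i ∈ S, γ.integral k s t (f i) := by
  simp only [integral_eq]
  rw [← MeasureTheory.integral_finsetSum S fun i hi => γ.integrable_sgn_smul k (hf i hi)]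
  simp only [Finset.smul_sum]

theorem norm_integral_le (γ : BVPath d T) (k : Fin d) {s t : ℝ} {f : ℝ → E} {C : ℝ}
    (h : ∀ u ∈ Ioc s t, ‖f u‖ ≤ C) :
    ‖γ.integral k s t f‖ ≤ C * (γ.varMeasure k).real (Ioc s t) := by
  rw [integral_eq]
  refine norm_setIntegral_le_of_norm_le_const (measure_lt_top _ _) fun u hu => ?_
  rw [norm_smul, Real.norm_eq_abs, abs_sgn, one_mul]
  exact h u hu

/-- The density has modulus one and the variation measure is finite, so summable constants already
dominate. -/
theorem hasSum_integral (γ : BVPath d T) (k : Fin d) {s t : ℝ} {ι : Type*} [Countable ι]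
    {f : ι → ℝ → E} {g : ℝ → E} {b : ι → ℝ} (hb : Summable b)
    (hm : ∀ i, AEStronglyMeasurable (f i) ((γ.varMeasure k).restrict (Ioc s t)))
    (hf : ∀ i, ∀ u ∈ Ioc s t, ‖f i u‖ ≤ b i)
    (hg : ∀ u ∈ Ioc s t, HasSum (fun i => f i u) (g u)) :
    HasSum (fun i => γ.integral k s t (f i)) (γ.integral k s t g) := by
  simp only [integral_eq]
  refine hasSum_integral_of_dominated_convergence (fun i _ => b i) (fun i => ?_) (fun i => ?_)
    (Eventually.of_forall fun _ => hb) ?_ ?_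
  · exact (γ.measurable_sgn k).aestronglyMeasurable.smul (hm i)
  · refine (ae_restrict_iff' measurableSet_Ioc).2 (Eventually.of_forall fun u hu => ?_)
    rw [norm_smul, Real.norm_eq_abs, abs_sgn, one_mul]
    exact hf i u hu
  · exact integrable_const _
  · refine (ae_restrict_iff' measurableSet_Ioc).2 (Eventually.of_forall fun u hu => ?_)
    exact (hg u hu).const_smul _

/-- The order of integration over a triangle can be exchanged. -/
theorem integral_integral_triangle (γ : BVPath d T) (k j : Fin d) (s t : ℝ) {F : ℝ → ℝ → ℝ}
    (hF : Measurable (Function.uncurry F)) {C : ℝ}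
    (hC : ∀ u x, s < u → u ≤ x → x ≤ t → |F u x| ≤ C) :
    γ.integral k s t (fun u => γ.integral j u t (fun x => F u x)) =
      γ.integral j s t (fun x => γ.integral k s x (fun u => F u x)) := by
  set μ := γ.varMeasure k
  set ν := γ.varMeasure j
  -- Both iterated integrals are integrals of this bounded function on the closed triangle. The
  -- order with x inside omits the diagonal point x = u, which has measure zero.
  set G : ℝ → ℝ → ℝ := fun u x =>
    if s < u ∧ u ≤ x ∧ x ≤ t then γ.sgn k u * (γ.sgn j x * F u x) else 0 with hG
  have hGm : Measurable (Function.uncurry G) := by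
    refine Measurable.ite ?_ ?_ measurable_const
    · refine MeasurableSet.inter ?_ (MeasurableSet.inter ?_ ?_)
      · exact measurableSet_lt measurable_const measurable_fst
      · exact measurableSet_le measurable_fst measurable_snd
      · exact measurableSet_le measurable_snd measurable_const
    · exact ((γ.measurable_sgn k).comp measurable_fst).mul
        (((γ.measurable_sgn j).comp measurable_snd).mul hF)
  have hGi : Integrable (Function.uncurry G) (μ.prod ν) := by
    refine Integrable.of_bound hGm.aestronglyMeasurable (max C 0)
      (Eventually.of_forall fun p => ?_)
    simp only [Function.uncurry, hG]
    split_ifs with h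
    · rw [Real.norm_eq_abs, abs_mul, abs_mul, abs_sgn, abs_sgn, one_mul, one_mul]
      exact (hC _ _ h.1 h.2.1 h.2.2).trans (le_max_left _ _)
    · simp
  have e1 : γ.integral k s t (fun u => γ.integral j u t (fun x => F u x)) =
      ∫ u, ∫ x, G u x ∂ν ∂μ := by
    rw [integral_eq, ← integral_indicator measurableSet_Ioc]
    congr 1
    ext u
    by_cases hu : u ∈ Ioc s t
    · rw [indicator_of_mem hu, integral_eq, smul_eq_mul, ← MeasureTheory.integral_const_mul,
        ← integral_Icc_eq_integral_Ioc, ← integral_indicator measurableSet_Icc]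
      congr 1
      ext x
      by_cases hx : x ∈ Icc u t
      · rw [indicator_of_mem hx]
        simp [hG, hu.1, hx.1, hx.2]
      · rw [indicator_of_notMem hx]
        have : ¬ (u ≤ x ∧ x ≤ t) := hx
        simp [hG, hu.1, this]
    · rw [indicator_of_notMem hu]
      have : ∀ x, ¬ (s < u ∧ u ≤ x ∧ x ≤ t) := fun x h => hu ⟨h.1, h.2.1.trans h.2.2⟩
      simp [hG, this]
  have e2 : γ.integral j s t (fun x => γ.integral k s x (fun u => F u x)) =
      ∫ x, ∫ u, G u x ∂μ ∂ν := by
    rw [integral_eq, ← integral_indicator measurableSet_Ioc]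
    congr 1
    ext x
    by_cases hx : x ∈ Ioc s t
    · rw [indicator_of_mem hx, integral_eq, smul_eq_mul, ← MeasureTheory.integral_const_mul,
        ← integral_indicator measurableSet_Ioc]
      congr 1
      ext u
      by_cases hu : u ∈ Ioc s x
      · rw [indicator_of_mem hu]
        simp [hG, hu.1, hu.2, hx.2]
        ring
      · rw [indicator_of_notMem hu]
        have : ¬ (s < u ∧ u ≤ x) := hu
        simp only [hG]
        rw [if_neg fun h => this ⟨h.1, h.2.1⟩]
    · rw [indicator_of_notMem hx]
      have : ∀ u, ¬ (s < u ∧ u ≤ x ∧ x ≤ t) := fun u h => hx ⟨h.1.trans_le h.2.1, h.2.2⟩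
      simp [hG, this]
  rw [e1, e2]
  exact integral_integral_swap hGi

end BVPath

/-! ### Telescoping bounds and uniform partitions -/

theorem succ_mul_pow_mul_sub_le {x y : ℝ} (hx : 0 ≤ x) (hxy : x ≤ y) (n : ℕ) :
    (n + 1) * (x ^ n * (y - x)) ≤ y ^ (n + 1) - x ^ (n + 1) := by
  induction n with
  | zero => simp
  | succ n ih =>
    have h1 : 0 ≤ y ^ (n + 1) - x ^ (n + 1) :=
      sub_nonneg.2 (pow_le_pow_left₀ hx hxy _)
    calc ((n + 1 : ℕ) + 1 : ℝ) * (x ^ (n + 1) * (y - x))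
        = x * ((n + 1) * (x ^ n * (y - x))) + (y - x) * x ^ (n + 1) := by push_cast; ring
      _ ≤ y * (y ^ (n + 1) - x ^ (n + 1)) + (y - x) * x ^ (n + 1) := by
          exact add_le_add ((mul_le_mul_of_nonneg_left ih hx).trans
            (mul_le_mul_of_nonneg_right hxy h1)) le_rfl
      _ = y ^ (n + 1 + 1) - x ^ (n + 1 + 1) := by ring

/-- A left-endpoint rectangle lies below the graph of the increasing function u^n/n!. The right side
telescopes over a partition, which carries the factorial bound through Riemann sums. -/
theorem pow_div_factorial_mul_sub_le {x y : ℝ} (hx : 0 ≤ x) (hxy : x ≤ y) (n : ℕ) :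
    x ^ n / n.factorial * (y - x) ≤
      y ^ (n + 1) / (n + 1).factorial - x ^ (n + 1) / (n + 1).factorial := by
  have h := succ_mul_pow_mul_sub_le hx hxy n
  rw [← sub_div, le_div_iff₀ (by positivity), Nat.factorial_succ]
  push_cast
  have hn : (n.factorial : ℝ) ≠ 0 := by positivity
  calc x ^ n / n.factorial * (y - x) * ((n + 1) * n.factorial)
      = (n + 1) * (x ^ n * (y - x)) := by field_simp
    _ ≤ _ := h

/-- The `i`-th point of the uniform partition of `[s, t]` into `N` intervals. -/
def gridPoint (s t : ℝ) (N i : ℕ) : ℝ := s + (t - s) * (i / N)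

theorem gridPoint_zero (s t : ℝ) (N : ℕ) : gridPoint s t N 0 = s := by simp [gridPoint]

theorem gridPoint_self (s t : ℝ) {N : ℕ} (hN : N ≠ 0) : gridPoint s t N N = t := by
  have : (N : ℝ) ≠ 0 := by exact_mod_cast hN
  simp [gridPoint, this]

theorem gridPoint_mono {s t : ℝ} (hst : s ≤ t) (N : ℕ) : Monotone (gridPoint s t N) := by
  intro i j hij
  have : (i : ℝ) / N ≤ j / N := by gcongr
  have := mul_le_mul_of_nonneg_left this (sub_nonneg.2 hst)
  unfold gridPoint
  linarith

theorem gridPoint_mem {s t : ℝ} (hst : s ≤ t) {N i : ℕ} (hi : i ≤ N) :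
    gridPoint s t N i ∈ Icc s t := by
  rcases Nat.eq_zero_or_pos N with rfl | hN
  · simp [gridPoint, hst]
  · constructor
    · simpa [gridPoint_zero] using gridPoint_mono hst N (Nat.zero_le i)
    · simpa [gridPoint_self s t hN.ne'] using gridPoint_mono hst N hi

theorem gridPoint_succ_sub (s t : ℝ) (N i : ℕ) :
    gridPoint s t N (i + 1) - gridPoint s t N i = (t - s) / N := by
  simp only [gridPoint]
  push_cast
  ring

theorem gridPoint_affine (α β s t : ℝ) (N i : ℕ) :
    gridPoint (α * s + β) (α * t + β) N i = α * gridPoint s t N i + β := by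
  simp only [gridPoint]
  ring

/-! ### Riemann sums, decay and algebra of iterated integrals -/

namespace BVPath

variable {d : ℕ} {T : ℝ}

theorem integrableOn_of_continuous (γ : BVPath d T) (k : Fin d) (s t : ℝ) {f : ℝ → ℝ}
    (hf : Continuous f) : IntegrableOn f (Ioc s t) (γ.varMeasure k) :=
  (hf.continuousOn.integrableOn_compact isCompact_Icc).mono_set Ioc_subset_Icc_self

/-- For fixed u ≠ t₀, membership of u in (s, t] does not change for t near t₀, and t₀ itself is a
null set; dominated convergence concludes. -/
theorem continuous_integral (γ : BVPath d T) (k : Fin d) (s : ℝ) {f : ℝ → ℝ}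
    (hf : Continuous f) : Continuous fun t => γ.integral k s t f := by
  refine continuous_iff_continuousAt.2 fun t₀ => ?_
  obtain ⟨C, hC⟩ := (isCompact_Icc (a := s) (b := t₀ + 1)).exists_bound_of_continuousOn
    hf.continuousOn
  simp only [integral_eq, ← integral_indicator measurableSet_Ioc]
  refine continuousAt_of_dominated (bound := fun _ => max C 0)
    (Eventually.of_forall fun t => ?_) ?_ (integrable_const _) ?_
  · exact (((γ.measurable_sgn k).mul hf.measurable).indicator
      measurableSet_Ioc).aestronglyMeasurable
  · filter_upwards [eventually_le_nhds (lt_add_one t₀)] with t ht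
    refine Eventually.of_forall fun u => ?_
    by_cases hu : u ∈ Ioc s t
    · rw [indicator_of_mem hu, norm_smul, Real.norm_eq_abs, abs_sgn, one_mul]
      exact (hC u ⟨hu.1.le, hu.2.trans ht⟩).trans (le_max_left _ _)
    · rw [indicator_of_notMem hu]
      simp
  · have hae : ∀ᵐ u ∂γ.varMeasure k, u ≠ t₀ := by
      rw [ae_iff]
      simp
    filter_upwards [hae] with u hu
    rcases lt_or_gt_of_ne hu with h | h
    · refine (continuousAt_const (y := (Ioi s).indicator (fun u => γ.sgn k u • f u) u)).congr ?_
      filter_upwards [eventually_ge_nhds h] with t ht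
      by_cases hs : s < u
      · rw [indicator_of_mem (show u ∈ Ioi s from hs),
          indicator_of_mem (show u ∈ Ioc s t from ⟨hs, ht⟩)]
      · rw [indicator_of_notMem (show u ∉ Ioi s from hs), indicator_of_notMem fun h => hs h.1]
    · refine (continuousAt_const (y := (0 : ℝ))).congr ?_
      filter_upwards [eventually_lt_nhds h] with t ht
      rw [indicator_of_notMem fun h => not_le.2 ht h.2]

theorem sigRev_nil (γ : BVPath d T) (s t : ℝ) : γ.sigRev s [] t = 1 := rfl

theorem sigRev_cons (γ : BVPath d T) (s t : ℝ) (k : Fin d) (w : List (Fin d)) :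
    γ.sigRev s (k :: w) t = γ.integral k s t (γ.sigRev s w) := rfl

theorem continuous_sigRev (γ : BVPath d T) (s : ℝ) (w : List (Fin d)) :
    Continuous (γ.sigRev s w) := by
  induction w with
  | nil => exact continuous_const
  | cons k w ih => exact γ.continuous_integral k s ih

/-- The Stieltjes integral of a continuous function is the limit of its Riemann sums. -/
theorem tendsto_riemann_sum (γ : BVPath d T) (k : Fin d) {s t : ℝ} (hst : s ≤ t) {f : ℝ → ℝ}
    (hf : Continuous f) :
    Tendsto (fun N : ℕ => ∑ i ∈ Finset.range N, f (gridPoint s t N i) *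
      (γ.toFun (gridPoint s t N (i + 1)) k - γ.toFun (gridPoint s t N i) k))
      atTop (𝓝 (γ.integral k s t f)) := by
  set μ := γ.varMeasure k
  rw [Metric.tendsto_atTop]
  intro ε hε
  set M := μ.real (Ioc s t)
  have hM : 0 ≤ M := measureReal_nonneg
  -- The summand 1 covers the case M = 0 and makes the final estimate strict.
  have hc : 0 < ε / (M + 1) := by positivity
  obtain ⟨δ, hδ, hfδ⟩ := Metric.uniformContinuousOn_iff.1
    ((isCompact_Icc (a := s) (b := t)).uniformContinuousOn_of_continuous hf.continuousOn) _ hc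
  obtain ⟨N₀, hN₀⟩ := exists_nat_gt ((t - s) / δ)
  refine ⟨N₀ + 1, fun N hN => ?_⟩
  have hNpos : (0 : ℝ) < N := by exact_mod_cast (by omega : 0 < N)
  have hmesh : (t - s) / N < δ := by
    have : (N₀ : ℝ) ≤ N := by exact_mod_cast (by omega : N₀ ≤ N)
    rw [div_lt_iff₀ hNpos]
    rw [div_lt_iff₀ hδ] at hN₀
    nlinarith
  -- On each cell f differs from its left value by at most ε / (M + 1), so the error is at most that
  -- times the variation on the cell; the errors add up by additivity of the measure.
  have key : ∀ i ≤ N, ‖γ.integral k s (gridPoint s t N i) f -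
      ∑ j ∈ Finset.range i, f (gridPoint s t N j) *
        (γ.toFun (gridPoint s t N (j + 1)) k - γ.toFun (gridPoint s t N j) k)‖ ≤
      ε / (M + 1) * μ.real (Ioc s (gridPoint s t N i)) := by
    intro i hi
    induction i with
    | zero => simp [gridPoint_zero, integral_of_ge]
    | succ i ih =>
      have ih := ih (by omega)
      set a := gridPoint s t N i
      set b := gridPoint s t N (i + 1)
      have ha := gridPoint_mem hst (show i ≤ N by omega)
      have hb := gridPoint_mem hst hi
      have hab : a ≤ b := gridPoint_mono hst N (Nat.le_succ i)
      have hba : b - a = (t - s) / N := gridPoint_succ_sub s t N i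
      have e1 : γ.integral k s b f = γ.integral k s a f + γ.integral k a b f :=
        (γ.integral_add_adjacent k ha.1 hab (γ.integrableOn_of_continuous k s b hf)).symm
      have e2 : f a * (γ.toFun b k - γ.toFun a k) = γ.integral k a b fun _ => f a :=
        (γ.integral_const k hab _).symm
      have e3 : μ.real (Ioc s b) = μ.real (Ioc s a) + μ.real (Ioc a b) := by
        rw [← Ioc_union_Ioc_eq_Ioc ha.1 hab, measureReal_union
          (Ioc_disjoint_Ioc_of_le le_rfl) measurableSet_Ioc]
      have e4 : ‖γ.integral k a b f - γ.integral k a b fun _ => f a‖ ≤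
          ε / (M + 1) * μ.real (Ioc a b) := by
        rw [← γ.integral_sub k (γ.integrableOn_of_continuous k a b hf)
          (γ.integrableOn_of_continuous k a b continuous_const)]
        refine γ.norm_integral_le k fun u hu => ?_
        rw [← dist_eq_norm]
        refine (hfδ u ⟨ha.1.trans hu.1.le, hu.2.trans hb.2⟩ a ha ?_).le
        rw [Real.dist_eq, abs_of_nonneg (sub_nonneg.2 hu.1.le)]
        linarith [hu.2]
      rw [Finset.sum_range_succ, e1, e2, e3, mul_add]
      refine le_trans (le_of_eq ?_) ((norm_add_le _ _).trans (add_le_add ih e4))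
      congr 1
      ring
  have h := key N le_rfl
  rw [gridPoint_self s t (by omega)] at h
  rw [dist_comm, dist_eq_norm]
  refine h.trans_lt ?_
  rw [div_mul_eq_mul_div, div_lt_iff₀ (by positivity)]
  nlinarith

/-- The factorial decay of the signature, relative to a control of the increments. -/
theorem abs_sigRev_le (γ : BVPath d T) {s t : ℝ} {V : ℝ → ℝ}
    (hV : MonotoneOn V (Icc s t))
    (h : ∀ (k : Fin d) (x y : ℝ), s ≤ x → x ≤ y → y ≤ t →
      |γ.toFun y k - γ.toFun x k| ≤ V y - V x) (w : List (Fin d)) {u : ℝ} (hu : u ∈ Icc s t) :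
    |γ.sigRev s w u| ≤ (V u - V s) ^ w.length / w.length.factorial := by
  induction w generalizing u with
  | nil => simp [sigRev_nil]
  | cons k w ih =>
    rw [sigRev_cons]
    -- Riemann sums see only increments of the path, so any V dominating the increments serves as
    -- control, and the bound survives the limit.
    have hlim := (γ.tendsto_riemann_sum k hu.1 (γ.continuous_sigRev s w)).abs
    refine le_of_tendsto hlim (eventually_atTop.2 ⟨1, fun N hN => ?_⟩)
    have hs : s ∈ Icc s t := ⟨le_rfl, hu.1.trans hu.2⟩
    have hmem : ∀ i ≤ N, gridPoint s u N i ∈ Icc s t := fun i hi =>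
      Icc_subset_Icc_right hu.2 (gridPoint_mem hu.1 hi)
    set n := w.length
    calc |∑ i ∈ Finset.range N, γ.sigRev s w (gridPoint s u N i) *
          (γ.toFun (gridPoint s u N (i + 1)) k - γ.toFun (gridPoint s u N i) k)|
        ≤ ∑ i ∈ Finset.range N, ((V (gridPoint s u N (i + 1)) - V s) ^ (n + 1) /
            (n + 1).factorial - (V (gridPoint s u N i) - V s) ^ (n + 1) /
            (n + 1).factorial) := by
          refine (Finset.abs_sum_le_sum_abs _ _).trans (Finset.sum_le_sum fun i hi => ?_)
          have hi := Finset.mem_range.1 hi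
          have ha := hmem i hi.le
          have hb := hmem (i + 1) hi
          have hab := gridPoint_mono hu.1 N (Nat.le_succ i)
          have h0 : 0 ≤ V (gridPoint s u N i) - V s := sub_nonneg.2 (hV hs ha ha.1)
          rw [abs_mul]
          refine le_trans ?_ (pow_div_factorial_mul_sub_le h0
            (sub_le_sub_right (hV ha hb hab) _) n)
          refine mul_le_mul (ih ha) ?_ (abs_nonneg _) (by positivity)
          simpa using h k _ _ ha.1 hab hb.2
      _ = (V u - V s) ^ (n + 1) / (n + 1).factorial := by
          rw [Finset.sum_range_sub fun i => (V (gridPoint s u N i) - V s) ^ (n + 1) /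
            ((n + 1).factorial : ℝ), gridPoint_zero, gridPoint_self s u (by omega)]
          simp

/-- The signature is invariant under affine changes of time. -/
theorem sigRev_affine {T' : ℝ} (γ : BVPath d T) (η : BVPath d T') {α β s t : ℝ} (hα : 0 ≤ α)
    (h : ∀ r ∈ Icc s t, ∀ k, η.toFun r k - η.toFun s k =
      γ.toFun (α * r + β) k - γ.toFun (α * s + β) k) (w : List (Fin d)) {u : ℝ}
    (hu : u ∈ Icc s t) : η.sigRev s w u = γ.sigRev (α * s + β) w (α * u + β) := by
  induction w generalizing u with
  | nil => rfl
  | cons k w ih =>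
    rw [sigRev_cons, sigRev_cons]
    -- The affine map carries uniform partitions to uniform partitions, so both integrals are limits
    -- of the same Riemann sums.
    refine tendsto_nhds_unique (η.tendsto_riemann_sum k hu.1 (η.continuous_sigRev s w)) ?_
    have hle : α * s + β ≤ α * u + β := by
      have := mul_le_mul_of_nonneg_left hu.1 hα
      linarith
    refine (γ.tendsto_riemann_sum k hle (γ.continuous_sigRev _ w)).congr fun N => ?_
    refine Finset.sum_congr rfl fun i hi => ?_
    have hi := Finset.mem_range.1 hi
    have ha := Icc_subset_Icc_right hu.2 (gridPoint_mem hu.1 hi.le)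
    have hb := Icc_subset_Icc_right hu.2 (gridPoint_mem hu.1 (show i + 1 ≤ N from hi))
    rw [gridPoint_affine, gridPoint_affine, ih ha]
    congr 1
    have h1 := h _ ha k
    have h2 := h _ hb k
    linarith

/-- Chen's identity. -/
theorem sigRev_chen (γ : BVPath d T) {s u t : ℝ} (hsu : s ≤ u) (hut : u ≤ t)
    (w : List (Fin d)) : γ.sigRev s w t =
      ∑ i ∈ Finset.range (w.length + 1), γ.sigRev u (w.take i) t * γ.sigRev s (w.drop i) u := by
  induction w generalizing t with
  | nil => simp [sigRev_nil]
  | cons k w ih =>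
    rw [List.length_cons, Finset.sum_range_succ']
    simp only [List.take_succ_cons, List.drop_succ_cons, List.take_zero, List.drop_zero,
      sigRev_nil, one_mul]
    -- The head of the reversed word is the outermost integration. Its range is cut at u, and on (u,
    -- t] the integrand is expanded by induction; the piece over (s, u] is the term where nothing is
    -- taken.
    have e : γ.integral k u t (γ.sigRev s w) =
        ∑ i ∈ Finset.range (w.length + 1), γ.sigRev u (k :: w.take i) t *
          γ.sigRev s (w.drop i) u := by
      rw [γ.integral_congr k fun x hx => ih hx.1.le, integral_finset_sum]
      · simp only [integral_mul_const, sigRev_cons]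
      · intro i _
        exact γ.integrableOn_of_continuous k u t
          ((γ.continuous_sigRev u _).mul continuous_const)
    rw [sigRev_cons, ← γ.integral_add_adjacent k hsu hut
      (γ.integrableOn_of_continuous k s t (γ.continuous_sigRev s w)), e, add_comm, sigRev_cons]

/-- Joint measurability in both endpoints is what Fubini on the triangle needs. Writing the range of
integration as an indicator makes the integral a parameter integral of a jointly measurable
function. -/
theorem measurable_sigRev (γ : BVPath d T) (w : List (Fin d)) :
    Measurable fun p : ℝ × ℝ => γ.sigRev p.1 w p.2 := by
  induction w with
  | nil => exact measurable_const
  | cons k w ih =>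
    have e : (fun p : ℝ × ℝ => γ.sigRev p.1 (k :: w) p.2) = fun p : ℝ × ℝ =>
        ∫ x, (if p.1 < x ∧ x ≤ p.2 then γ.sgn k x * γ.sigRev p.1 w x else 0)
          ∂γ.varMeasure k := by
      ext p
      rw [sigRev_cons, integral_eq, ← integral_indicator measurableSet_Ioc]
      congr 1
      ext x
      simp only [indicator, mem_Ioc, smul_eq_mul]
    rw [e]
    have hm : Measurable fun q : (ℝ × ℝ) × ℝ =>
        if q.1.1 < q.2 ∧ q.2 ≤ q.1.2 then γ.sgn k q.2 * γ.sigRev q.1.1 w q.2 else 0 := by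
      refine Measurable.ite ?_ ?_ measurable_const
      · exact (measurableSet_lt (measurable_fst.comp measurable_fst) measurable_snd).inter
          (measurableSet_le measurable_snd (measurable_snd.comp measurable_fst))
      · exact ((γ.measurable_sgn k).comp measurable_snd).mul
          (ih.comp ((measurable_fst.comp measurable_fst).prodMk measurable_snd))
    exact (hm.stronglyMeasurable.integral_prod_right' (ν := γ.varMeasure k)).measurable

/-- The total variation of the coordinates of `γ` up to time `t`. -/
def control (γ : BVPath d T) (t : ℝ) : ℝ := ∑ k, (γ.varMeasure k).real (Iic t)

theorem control_mono (γ : BVPath d T) : Monotone γ.control := fun _ _ h =>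
  Finset.sum_le_sum fun _ _ => measureReal_mono (Iic_subset_Iic.2 h)

theorem abs_sub_le_control (γ : BVPath d T) (k : Fin d) {x y : ℝ} (h : x ≤ y) :
    |γ.toFun y k - γ.toFun x k| ≤ γ.control y - γ.control x := by
  have e : ∀ j, (γ.varMeasure j).real (Iic y) - (γ.varMeasure j).real (Iic x) =
      (γ.varMeasure j).real (Ioc x y) := fun j => by
    rw [← Iic_union_Ioc_eq_Iic h, measureReal_union (by
      rw [Set.disjoint_left]
      exact fun a ha hb => not_lt.2 ha hb.1) measurableSet_Ioc]
    ring
  rw [control, control, ← Finset.sum_sub_distrib]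
  simp only [e]
  have h1 := γ.norm_integral_le k (s := x) (t := y) (f := fun _ => (1 : ℝ)) (C := 1) (by simp)
  rw [integral_const _ _ h, one_mul, one_mul, Real.norm_eq_abs] at h1
  exact h1.trans (Finset.single_le_sum (f := fun j => (γ.varMeasure j).real (Ioc x y))
    (fun j _ => measureReal_nonneg) (Finset.mem_univ k))

theorem abs_sigRev_le_control (γ : BVPath d T) {s u v t : ℝ} (hsu : s ≤ u) (huv : u ≤ v)
    (hvt : v ≤ t) (w : List (Fin d)) : |γ.sigRev u w v| ≤
      (γ.control t - γ.control s) ^ w.length / w.length.factorial := by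
  refine (γ.abs_sigRev_le (V := γ.control) (s := u) (t := v) (γ.control_mono.monotoneOn _)
    (fun k x y _ hxy _ => γ.abs_sub_le_control k hxy) w ⟨huv, le_rfl⟩).trans ?_
  have h1 := γ.control_mono hsu
  have h2 := γ.control_mono huv
  have h3 := γ.control_mono hvt
  gcongr

/-- A letter is inserted between two iterated integrals by integrating over the time that
separates them. -/
theorem integral_sigRev_mul_sigRev (γ : BVPath d T) (k : Fin d) (s t : ℝ)
    (p q : List (Fin d)) :
    γ.integral k s t (fun u => γ.sigRev s p u * γ.sigRev u q t) =
      γ.sigRev s (q ++ k :: p) t := by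
  induction q generalizing t with
  | nil => simp [sigRev_nil, sigRev_cons]
  | cons j q ih =>
    -- The outermost letter j is moved outside the integral over u by exchanging the order of
    -- integration; the induction hypothesis then applies at its time x.
    have e : ∀ u, γ.sigRev s p u * γ.sigRev u (j :: q) t =
        γ.integral j u t fun x => γ.sigRev s p u * γ.sigRev u q x := fun u => by
      rw [sigRev_cons]
      exact (γ.integral_smul_left j u t (γ.sigRev s p u) (γ.sigRev u q)).symm
    simp only [e]
    rw [γ.integral_integral_triangle k j s t (F := fun u x => γ.sigRev s p u * γ.sigRev u q x)
      (C := (γ.control t - γ.control s) ^ p.length / p.length.factorial *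
        ((γ.control t - γ.control s) ^ q.length / q.length.factorial))]
    · simp only [ih, List.cons_append, sigRev_cons]
    · exact ((γ.continuous_sigRev s p).measurable.comp measurable_fst).mul
        (γ.measurable_sigRev q)
    · intro u x hsu hux hxt
      rw [abs_mul]
      exact mul_le_mul (γ.abs_sigRev_le_control le_rfl hsu.le (hux.trans hxt) p)
        (γ.abs_sigRev_le_control hsu.le hux hxt q) (abs_nonneg _)
        (le_trans (abs_nonneg _) (γ.abs_sigRev_le_control le_rfl hsu.le (hux.trans hxt) p))

end BVPath

/-! ### Power series in the signature -/

/-- There are d^n words of length n, so grouping by length leaves the exponential series of dx. -/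
theorem summable_pow_div_factorial_words {d : ℕ} (x : ℝ) (hx : 0 ≤ x) :
    Summable fun w : List (Fin d) => x ^ w.length / w.length.factorial := by
  rw [← (Equiv.sigmaFiberEquiv (List.length (α := Fin d))).summable_iff]
  have hfin : ∀ n, Fintype {w : List (Fin d) // w.length = n} := fun n =>
    inferInstanceAs (Fintype (List.Vector (Fin d) n))
  have hcard : ∀ n, Nat.card {w : List (Fin d) // w.length = n} = d ^ n := fun n => by
    change Nat.card (List.Vector (Fin d) n) = d ^ n
    rw [Nat.card_eq_fintype_card, card_vector, Fintype.card_fin]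
  have hval : ∀ p : (n : ℕ) × {w : List (Fin d) // w.length = n},
      ((fun w : List (Fin d) => x ^ w.length / (w.length.factorial : ℝ)) ∘
        Equiv.sigmaFiberEquiv (List.length (α := Fin d))) p = x ^ p.1 / p.1.factorial := by
    rintro ⟨n, w, rfl⟩
    rfl
  rw [summable_sigma_of_nonneg fun p => by rw [hval]; positivity]
  refine ⟨fun n => Summable.of_finite, ?_⟩
  refine (Real.summable_pow_div_factorial (d * x)).congr fun n => ?_
  simp only [hval, tsum_const, hcard, nsmul_eq_mul]
  push_cast
  ring

/-- The binomial theorem divided by n!. It sums the bounds of the terms in Chen's identity. -/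
theorem sum_pow_div_factorial_mul (V : ℝ) (n : ℕ) :
    ∑ j ∈ Finset.range (n + 1), 1 / (j.factorial : ℝ) * (V ^ (n - j) / (n - j).factorial) =
      (1 + V) ^ n / n.factorial := by
  rw [add_pow, Finset.sum_div]
  refine Finset.sum_congr rfl fun j hj => ?_
  have hj : j ≤ n := Nat.lt_succ_iff.1 (Finset.mem_range.1 hj)
  rw [Nat.cast_choose ℝ hj, one_pow, one_mul]
  have h1 : (n.factorial : ℝ) ≠ 0 := by positivity
  have h2 : (j.factorial : ℝ) ≠ 0 := by positivity
  have h3 : ((n - j).factorial : ℝ) ≠ 0 := by positivity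
  field_simp

/-- Coefficients on words of at most exponential growth. -/
def ExpBounded {d : ℕ} (c : List (Fin d) → ℂ) : Prop :=
  ∃ K M : ℝ, 0 ≤ K ∧ 0 ≤ M ∧ ∀ w, ‖c w‖ ≤ K * M ^ w.length

namespace ExpBounded

variable {d : ℕ} {b c : List (Fin d) → ℂ}

theorem of_le {M : ℝ} (hM : 0 ≤ M) (h : ∀ w, ‖c w‖ ≤ M ^ w.length) : ExpBounded c :=
  ⟨1, M, zero_le_one, hM, by simpa using h⟩

theorem congr (hc : ExpBounded c) (h : ∀ w, c w = b w) : ExpBounded b := by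
  rwa [← show c = b from funext h]

theorem zero : ExpBounded fun _ : List (Fin d) => (0 : ℂ) :=
  ⟨0, 0, le_rfl, le_rfl, by simp⟩

theorem add (hb : ExpBounded b) (hc : ExpBounded c) : ExpBounded fun w => b w + c w := by
  obtain ⟨K, M, hK, hM, h⟩ := hb
  obtain ⟨K', M', hK', hM', h'⟩ := hc
  refine ⟨K + K', max M M', add_nonneg hK hK', le_max_of_le_left hM, fun w => ?_⟩
  calc ‖b w + c w‖ ≤ K * M ^ w.length + K' * M' ^ w.length :=
        (norm_add_le _ _).trans (add_le_add (h w) (h' w))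
    _ ≤ K * max M M' ^ w.length + K' * max M M' ^ w.length := by
        gcongr
        · exact le_max_left _ _
        · exact le_max_right _ _
    _ = _ := by ring

theorem const_mul (hc : ExpBounded c) (z : ℂ) : ExpBounded fun w => z * c w := by
  obtain ⟨K, M, hK, hM, h⟩ := hc
  refine ⟨‖z‖ * K, M, by positivity, hM, fun w => ?_⟩
  rw [norm_mul, mul_assoc]
  exact mul_le_mul_of_nonneg_left (h w) (norm_nonneg _)

theorem sub (hb : ExpBounded b) (hc : ExpBounded c) : ExpBounded fun w => b w - c w := by
  simpa [sub_eq_add_neg] using hb.add (hc.const_mul (-1))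

theorem finset_sum {ι : Type*} (S : Finset ι) {f : ι → List (Fin d) → ℂ}
    (h : ∀ i ∈ S, ExpBounded (f i)) : ExpBounded fun w => ∑ i ∈ S, f i w := by
  classical
  induction S using Finset.induction_on with
  | empty => simpa using zero
  | insert i S hi ih =>
    simp only [Finset.sum_insert hi]
    exact (h i (Finset.mem_insert_self i S)).add
      (ih fun j hj => h j (Finset.mem_insert_of_mem hj))

theorem list_sum {ι : Type*} (L : List ι) {f : ι → List (Fin d) → ℂ}
    (h : ∀ i, ExpBounded (f i)) : ExpBounded fun w => (L.map fun i => f i w).sum := by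
  induction L with
  | nil => simpa using zero
  | cons i L ih => simpa using (h i).add ih

theorem append (hc : ExpBounded c) (z : List (Fin d)) : ExpBounded fun w => c (w ++ z) := by
  obtain ⟨K, M, hK, hM, h⟩ := hc
  refine ⟨K * M ^ z.length, M, by positivity, hM, fun w => (h _).trans (le_of_eq ?_)⟩
  rw [List.length_append, pow_add]
  ring

theorem I_pow_mul (hc : ExpBounded c) : ExpBounded fun w => Complex.I ^ w.length * c w := by
  obtain ⟨K, M, hK, hM, h⟩ := hc
  exact ⟨K, M, hK, hM, fun w => by simpa using h w⟩

theorem summable_mul (hc : ExpBounded c) {V : ℝ} (hV : 0 ≤ V) :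
    Summable fun w => ‖c w‖ * (V ^ w.length / w.length.factorial) := by
  obtain ⟨K, M, hK, hM, h⟩ := hc
  refine Summable.of_nonneg_of_le (fun w => by positivity) (fun w => ?_)
    ((summable_pow_div_factorial_words (M * V) (by positivity)).mul_left K)
  calc ‖c w‖ * (V ^ w.length / w.length.factorial)
      ≤ K * M ^ w.length * (V ^ w.length / w.length.factorial) :=
        mul_le_mul_of_nonneg_right (h w) (by positivity)
    _ = _ := by rw [mul_pow]; ring

end ExpBounded

variable {d : ℕ} {T : ℝ}

/-- The functional `∑_w c_w S^w_{s,t}(γ)`. -/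
def pathSeries (c : List (Fin d) → ℂ) (γ : BVPath d T) (s t : ℝ) : ℂ :=
  ∑' w : List (Fin d), c w * (γ.sig w s t : ℂ)

theorem sigFunctional_eq_pathSeries (a : List (Fin d) → ℂ) (γ : BVPath d T) (s t : ℝ) :
    sigFunctional a γ s t = pathSeries (fun w => Complex.I ^ w.length * a w) γ s t := rfl

/-- A bound for the variation of `γ` over `[s, t]`. -/
def BVPath.controlOn (γ : BVPath d T) (s t : ℝ) : ℝ := γ.control t - γ.control s

theorem BVPath.controlOn_nonneg (γ : BVPath d T) {s t : ℝ} (h : s ≤ t) : 0 ≤ γ.controlOn s t :=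
  sub_nonneg.2 (γ.control_mono h)

theorem BVPath.abs_sig_le (γ : BVPath d T) {s u v t : ℝ} (hsu : s ≤ u) (huv : u ≤ v)
    (hvt : v ≤ t) (w : List (Fin d)) :
    |γ.sig w u v| ≤ γ.controlOn s t ^ w.length / w.length.factorial := by
  simpa using! γ.abs_sigRev_le_control hsu huv hvt w.reverse

theorem norm_mul_sig_le (c : List (Fin d) → ℂ) (γ : BVPath d T) {s u v t : ℝ} (hsu : s ≤ u)
    (huv : u ≤ v) (hvt : v ≤ t) (w : List (Fin d)) :
    ‖c w * (γ.sig w u v : ℂ)‖ ≤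
      ‖c w‖ * (γ.controlOn s t ^ w.length / w.length.factorial) := by
  rw [norm_mul, Complex.norm_real]
  exact mul_le_mul_of_nonneg_left (γ.abs_sig_le hsu huv hvt w) (norm_nonneg _)

theorem summable_norm_pathSeries {c : List (Fin d) → ℂ} (hc : ExpBounded c) (γ : BVPath d T)
    {s t : ℝ} (h : s ≤ t) : Summable fun w => ‖c w * (γ.sig w s t : ℂ)‖ :=
  Summable.of_nonneg_of_le (fun _ => norm_nonneg _)
    (fun w => norm_mul_sig_le c γ le_rfl h le_rfl w)
    (hc.summable_mul (γ.controlOn_nonneg h))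

theorem hasSum_pathSeries {c : List (Fin d) → ℂ} (hc : ExpBounded c) (γ : BVPath d T)
    {s t : ℝ} (h : s ≤ t) :
    HasSum (fun w => c w * (γ.sig w s t : ℂ)) (pathSeries c γ s t) :=
  (summable_norm_pathSeries hc γ h).of_norm.hasSum

theorem pathSeries_add {b c : List (Fin d) → ℂ} (hb : ExpBounded b) (hc : ExpBounded c)
    (γ : BVPath d T) {s t : ℝ} (h : s ≤ t) :
    pathSeries (fun w => b w + c w) γ s t = pathSeries b γ s t + pathSeries c γ s t := by
  have h1 := (hasSum_pathSeries hb γ h).add (hasSum_pathSeries hc γ h)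
  rw [← h1.tsum_eq, pathSeries]
  simp only [add_mul]

theorem pathSeries_const_mul (z : ℂ) (c : List (Fin d) → ℂ) (γ : BVPath d T) (s t : ℝ) :
    pathSeries (fun w => z * c w) γ s t = z * pathSeries c γ s t := by
  rw [pathSeries, pathSeries, ← tsum_mul_left]
  simp only [mul_assoc]

theorem pathSeries_zero (γ : BVPath d T) (s t : ℝ) :
    pathSeries (fun _ => 0) γ s t = 0 := by
  simp [pathSeries]

theorem pathSeries_finset_sum {ι : Type*} (S : Finset ι) {f : ι → List (Fin d) → ℂ}
    (hf : ∀ i ∈ S, ExpBounded (f i)) (γ : BVPath d T) {s t : ℝ} (h : s ≤ t) :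
    pathSeries (fun w => ∑ i ∈ S, f i w) γ s t = ∑ i ∈ S, pathSeries (f i) γ s t := by
  have h1 := hasSum_sum fun i hi => hasSum_pathSeries (hf i hi) γ h
  rw [← h1.tsum_eq, pathSeries]
  simp only [Finset.sum_mul]

theorem pathSeries_list_sum {ι : Type*} (L : List ι) {f : ι → List (Fin d) → ℂ}
    (hf : ∀ i, ExpBounded (f i)) (γ : BVPath d T) {s t : ℝ} (h : s ≤ t) :
    pathSeries (fun w => (L.map fun i => f i w).sum) γ s t =
      (L.map fun i => pathSeries (f i) γ s t).sum := by
  induction L with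
  | nil => simpa using pathSeries_zero γ s t
  | cons i L ih =>
    simp only [List.map_cons, List.sum_cons]
    rw [pathSeries_add (hf i) (ExpBounded.list_sum L hf) γ h, ih]

/-! ### Vertical derivatives -/

section VerticalDerivative

variable [hT : Fact (0 < T)]

theorem BVPath.sig_segment (γ : BVPath d T) {s u : ℝ} (hsu : s ≤ u) (w : List (Fin d)) :
    (γ.segment s u).sig w 0 T = γ.sig w s u := by
  have hT' := hT.out
  have h := γ.sigRev_affine (γ.segment s u) (α := (u - s) / T) (β := s) (s := 0) (t := T)
    (div_nonneg (sub_nonneg.2 hsu) hT'.le) (fun r hr k => ?_) w.reverse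
    (show T ∈ Icc 0 T from ⟨hT'.le, le_rfl⟩)
  · rw [sig, sig, h, mul_zero, zero_add, div_mul_cancel₀ _ hT'.ne', sub_add_cancel]
  · rw [γ.segment_of_mem s u hr, γ.segment_of_mem s u ⟨le_rfl, hT'.le⟩]
    have e : s + (u - s) * (r / T) = (u - s) / T * r + s := by ring
    simp [e]

theorem pathSeries_segment (c : List (Fin d) → ℂ) (γ : BVPath d T) {s u : ℝ} (hsu : s ≤ u) :
    pathSeries c (γ.segment s u) 0 T = pathSeries c γ s u := by
  simp only [pathSeries, γ.sig_segment hsu]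

theorem BVPath.sigRev_concat_left (γ σ : BVPath d T) (w : List (Fin d)) :
    (γ.concat σ).sigRev 0 w (T / 2) = γ.sigRev 0 w T := by
  have hT' := hT.out
  have h := γ.sigRev_affine (γ.concat σ) (α := 2) (β := 0) (s := 0) (t := T / 2) zero_le_two
    (fun r hr k => ?_) w (show T / 2 ∈ Icc 0 (T / 2) from ⟨by linarith, le_rfl⟩)
  · rw [h]
    congr 1 <;> ring
  · rw [γ.concat_of_le σ hr.2, γ.concat_of_le σ (by linarith)]
    simp

theorem BVPath.concat_line_sub (γ : BVPath d T) (i k : Fin d) (h : ℝ) {x y : ℝ}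
    (hx : T / 2 ≤ x) (hxy : x ≤ y) (hy : y ≤ T) :
    (γ.concat (line i h)).toFun y k - (γ.concat (line i h)).toFun x k =
      if k = i then h * (2 * (y - x) / T) else 0 := by
  have hT' := hT.out
  rw [concat_of_ge _ _ hx, concat_of_ge _ _ (hx.trans hxy)]
  have c1 : clamp T (2 * (x - T / 2)) = 2 * (x - T / 2) := by
    rw [clamp, min_eq_right (by linarith), max_eq_right (by linarith)]
  have c2 : clamp T (2 * (y - T / 2)) = 2 * (y - T / 2) := by
    rw [clamp, min_eq_right (by linarith), max_eq_right (by linarith)]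
  simp only [line, c1, c2]
  by_cases hk : k = i
  · simp [hk]
    ring
  · simp [hk]

theorem BVPath.sigRev_concat_line_singleton (γ : BVPath d T) (i k : Fin d) (h : ℝ) :
    (γ.concat (line i h)).sigRev (T / 2) [k] T = if k = i then h else 0 := by
  have hT' := hT.out
  rw [sigRev_cons]
  have h1 := (γ.concat (line i h)).integral_const k (show T / 2 ≤ T by linarith) 1
  rw [γ.concat_line_sub i k h le_rfl (by linarith) le_rfl, one_mul] at h1
  refine h1.trans ?_
  split_ifs
  · field_simp
    ring
  · rfl

theorem BVPath.abs_sigRev_concat_line_le (γ : BVPath d T) (i : Fin d) (h : ℝ)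
    (w : List (Fin d)) :
    |(γ.concat (line i h)).sigRev (T / 2) w T| ≤ |h| ^ w.length / w.length.factorial := by
  have hT' := hT.out
  -- After T / 2 the path is a line of constant speed 2|h|/T, so a linear control with total
  -- increase |h| suffices.
  have h1 := (γ.concat (line i h)).abs_sigRev_le (s := T / 2) (t := T)
    (V := fun x => |h| * (2 * x / T)) ?_ ?_ w (u := T) ⟨by linarith, le_rfl⟩
  · refine h1.trans (le_of_eq ?_)
    congr 2
    field_simp
    ring
  · intro x _ y _ hxy
    dsimp only
    gcongr
  · intro k x y hx hxy hy
    rw [γ.concat_line_sub i k h hx hxy hy]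
    have h2 : 0 ≤ 2 * (y - x) / T := div_nonneg (by linarith) hT'.le
    have e : |h| * (2 * y / T) - |h| * (2 * x / T) = |h| * (2 * (y - x) / T) := by ring
    rw [e]
    split_ifs
    · rw [abs_mul, abs_of_nonneg h2]
    · rw [abs_zero]
      positivity

/-- The derivative of `S^w` in the vertical direction `i`, for the word `w` in reverse order. -/
def BVPath.sigRevDeriv (γ : BVPath d T) (i : Fin d) : List (Fin d) → ℝ
  | [] => 0
  | k :: w => if k = i then γ.sigRev 0 w T else 0

/-- In Chen's identity at T / 2, the terms with zero or one letter on the line are the value and h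
times the derivative. Every other term has at least two letters there, hence a factor h². The bound
is explicit in w, so that it can be summed over words. -/
theorem BVPath.abs_sigRev_concat_line_sub_le (γ : BVPath d T) (i : Fin d) {h : ℝ}
    (hh : |h| ≤ 1) (w : List (Fin d)) :
    |(γ.concat (line i h)).sigRev 0 w T - γ.sigRev 0 w T - h * γ.sigRevDeriv i w| ≤
      h ^ 2 * ((1 + γ.controlOn 0 T) ^ w.length / w.length.factorial) := by
  have hT' := hT.out
  have hV := γ.controlOn_nonneg hT'.le
  cases w with
  | nil =>
    simp [sigRev_nil, sigRevDeriv]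
    positivity
  | cons k w =>
    have hchen := (γ.concat (line i h)).sigRev_chen (s := 0) (u := T / 2) (t := T)
      (by linarith) (by linarith) (k :: w)
    simp only [sigRev_concat_left] at hchen
    rw [List.length_cons, Finset.sum_range_succ', Finset.sum_range_succ'] at hchen
    have e : (γ.concat (line i h)).sigRev 0 (k :: w) T - γ.sigRev 0 (k :: w) T -
        h * γ.sigRevDeriv i (k :: w) = ∑ j ∈ Finset.range w.length,
          (γ.concat (line i h)).sigRev (T / 2) ((k :: w).take (j + 1 + 1)) T *
            γ.sigRev 0 ((k :: w).drop (j + 1 + 1)) T := by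
      rw [hchen]
      simp only [zero_add, List.take_succ_cons, List.take_zero, List.drop_succ_cons,
        List.drop_zero, sigRev_concat_line_singleton, sigRev_nil, sigRevDeriv]
      split_ifs <;> ring
    rw [e]
    have hbig := sum_pow_div_factorial_mul (γ.controlOn 0 T) (k :: w).length
    -- The binomial sum also contains the terms j = 0, 1 that the remainder lacks; they are
    -- nonnegative and are discarded.
    rw [← hbig, List.length_cons, Finset.sum_range_succ', Finset.sum_range_succ', mul_add,
      mul_add, Finset.mul_sum]
    refine ((Finset.abs_sum_le_sum_abs _ _).trans (Finset.sum_le_sum fun j hj => ?_)).trans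
      (le_add_of_le_of_nonneg (le_add_of_nonneg_right (by positivity)) (by positivity))
    have hj := Finset.mem_range.1 hj
    rw [abs_mul, ← mul_assoc]
    have hl : ((k :: w).take (j + 1 + 1)).length = j + 1 + 1 := by
      rw [List.length_take, List.length_cons]
      omega
    have h1 := γ.abs_sigRev_concat_line_le i h ((k :: w).take (j + 1 + 1))
    have h2 := γ.abs_sigRev_le_control le_rfl hT'.le le_rfl ((k :: w).drop (j + 1 + 1))
    rw [hl] at h1
    rw [List.length_drop, List.length_cons] at h2
    refine mul_le_mul (h1.trans ?_) h2 (abs_nonneg _) (by positivity)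
    rw [mul_one_div]
    gcongr
    rw [← sq_abs h, add_assoc, pow_add]
    exact mul_le_of_le_one_left (by positivity) (pow_le_one₀ (abs_nonneg _) hh)

/-- Only words ending in i have a nonzero derivative, and w ↦ wi enumerates them. -/
theorem hasSum_sigRevDeriv {c : List (Fin d) → ℂ} (hc : ExpBounded c) (γ : BVPath d T)
    (i : Fin d) :
    HasSum (fun w => c w * (γ.sigRevDeriv i w.reverse : ℂ))
      (pathSeries (fun w => c (w ++ [i])) γ 0 T) := by
  have hinj : Function.Injective fun w : List (Fin d) => w ++ [i] :=
    List.append_left_injective [i]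
  rw [← hinj.hasSum_iff]
  · refine (hasSum_pathSeries (hc.append [i]) γ hT.out.le).congr_fun ?_
    simp [BVPath.sigRevDeriv, BVPath.sig]
  · intro w hw
    rcases List.eq_nil_or_concat w with rfl | ⟨p, k, rfl⟩
    · simp [BVPath.sigRevDeriv]
    · have hk : k ≠ i := fun hk => hw ⟨p, by simp [hk]⟩
      simp [BVPath.sigRevDeriv, hk]

/-- The remainder bounds h² (1 + V)^n / n! stay summable against exponentially bounded coefficients,
so the difference quotient of the whole series has error at most |h| B. -/
theorem tendsto_pathSeries_concat_line {c : List (Fin d) → ℂ} (hc : ExpBounded c)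
    (γ : BVPath d T) (i : Fin d) :
    Tendsto (fun h : ℝ => (pathSeries c (γ.concat (BVPath.line i h)) 0 T -
      pathSeries c γ 0 T) / (h : ℂ)) (𝓝[≠] 0)
      (𝓝 (pathSeries (fun w => c (w ++ [i])) γ 0 T)) := by
  have hT' := hT.out
  have hV := γ.controlOn_nonneg hT'.le
  set B := ∑' w, ‖c w‖ * ((1 + γ.controlOn 0 T) ^ w.length / w.length.factorial)
  have hB : 0 ≤ B := tsum_nonneg fun w => by positivity
  have key : ∀ h : ℝ, |h| ≤ 1 → ‖pathSeries c (γ.concat (BVPath.line i h)) 0 T -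
      pathSeries c γ 0 T - h * pathSeries (fun w => c (w ++ [i])) γ 0 T‖ ≤ h ^ 2 * B := by
    intro h hh
    have hs := ((hasSum_pathSeries hc (γ.concat (BVPath.line i h)) hT'.le).sub
      (hasSum_pathSeries hc γ hT'.le)).sub ((hasSum_sigRevDeriv hc γ i).mul_left (h : ℂ))
    have hb := ((hc.summable_mul (V := 1 + γ.controlOn 0 T) (by positivity)).hasSum).mul_left
      (h ^ 2)
    refine hs.norm_le_of_bounded hb fun w => ?_
    have e : c w * ((γ.concat (BVPath.line i h)).sig w 0 T : ℂ) - c w * (γ.sig w 0 T : ℂ) -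
        h * (c w * (γ.sigRevDeriv i w.reverse : ℂ)) =
        c w * (((γ.concat (BVPath.line i h)).sigRev 0 w.reverse T -
          γ.sigRev 0 w.reverse T - h * γ.sigRevDeriv i w.reverse : ℝ) : ℂ) := by
      simp only [BVPath.sig]
      push_cast
      ring
    rw [e, norm_mul, Complex.norm_real, mul_left_comm]
    refine mul_le_mul_of_nonneg_left ?_ (norm_nonneg _)
    simpa using γ.abs_sigRev_concat_line_sub_le i hh w.reverse
  rw [tendsto_iff_norm_sub_tendsto_zero]
  have hlim : Tendsto (fun h : ℝ => |h| * B) (𝓝[≠] 0) (𝓝 0) := by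
    have : Tendsto (fun h : ℝ => |h| * B) (𝓝 0) (𝓝 (|0| * B)) :=
      (continuous_abs.mul continuous_const).tendsto 0
    rw [abs_zero, zero_mul] at this
    exact this.mono_left nhdsWithin_le_nhds
  refine squeeze_zero' (Eventually.of_forall fun _ => norm_nonneg _) ?_ hlim
  have h1 : ∀ᶠ h : ℝ in 𝓝[≠] 0, |h| ≤ 1 := by
    refine nhdsWithin_le_nhds ?_
    filter_upwards [Metric.ball_mem_nhds (0 : ℝ) one_pos] with h hh
    rw [Metric.mem_ball, Real.dist_eq, sub_zero] at hh
    exact hh.le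
  filter_upwards [h1, self_mem_nhdsWithin] with h hh hne
  have hne : h ≠ 0 := hne
  have hneC : (h : ℂ) ≠ 0 := by exact_mod_cast hne
  rw [div_sub' hneC, norm_div, Complex.norm_real, div_le_iff₀ (by positivity)]
  refine (key h hh).trans (le_of_eq ?_)
  rw [Real.norm_eq_abs, ← sq_abs]
  ring

theorem verticalDeriv_pathSeries {c : List (Fin d) → ℂ} (hc : ExpBounded c) (i : Fin d) :
    verticalDeriv i (fun η : BVPath d T => pathSeries c η 0 T) =
      fun η => pathSeries (fun w => c (w ++ [i])) η 0 T := by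
  ext γ
  exact (tendsto_pathSeries_concat_line hc γ i).limUnder_eq

/-- The rightmost derivative acts first, and each later one places its letter in front of those
already appended. The appended word is therefore z, not its reverse. -/
theorem verticalDerivWord_pathSeries {c : List (Fin d) → ℂ} (hc : ExpBounded c)
    (z : List (Fin d)) :
    verticalDerivWord z (fun η : BVPath d T => pathSeries c η 0 T) =
      fun η => pathSeries (fun w => c (w ++ z)) η 0 T := by
  induction z with
  | nil => simp [verticalDerivWord]
  | cons i z ih =>
    have h := verticalDeriv_pathSeries (T := T) (hc.append z) i
    simp only [List.append_assoc, List.singleton_append] at h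
    rw [← h, ← ih]
    rfl

/-- The coefficients of a power series in the signature are determined by its values. -/
theorem eq_of_pathSeries_eq {b c : List (Fin d) → ℂ} (hb : ExpBounded b) (hc : ExpBounded c)
    (h : ∀ γ : BVPath d T, pathSeries b γ 0 T = pathSeries c γ 0 T) : b = c := by
  have hT' := hT.out
  -- On the zero path only the empty word contributes, so evaluating ∇^z of a series there isolates
  -- the coefficient of z.
  let o : BVPath d T := ⟨fun _ => 0, continuous_const, by
    unfold BoundedVariationOn
    rw [eVariationOn.constant_on]
    · simp
    · rintro _ ⟨a, _, rfl⟩ _ ⟨b, _, rfl⟩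
      rfl, fun _ _ => rfl, fun _ _ => rfl⟩
  have ho : ∀ w : List (Fin d), w ≠ [] → o.sig w 0 T = 0 := fun w hw => by
    have h1 := o.abs_sigRev_le (s := 0) (t := T) (V := fun _ => 0) (fun _ _ _ _ _ => le_rfl)
      (fun k x y _ _ _ => by simp [o]) w.reverse (u := T) ⟨hT'.le, le_rfl⟩
    have h2 : w.length ≠ 0 := fun h => hw (List.length_eq_zero_iff.1 h)
    rw [sub_self, List.length_reverse, zero_pow h2, zero_div] at h1
    exact abs_nonpos_iff.1 h1
  have hz : ∀ c : List (Fin d) → ℂ, pathSeries c o 0 T = c [] := fun c => by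
    rw [pathSeries, tsum_eq_single [] fun w hw => by rw [ho w hw]; simp]
    simp [BVPath.sig_nil]
  have hF : (fun η : BVPath d T => pathSeries b η 0 T) = fun η => pathSeries c η 0 T :=
    funext h
  ext z
  have hv := congrFun (congrArg (verticalDerivWord z) hF) o
  rw [verticalDerivWord_pathSeries hb, verticalDerivWord_pathSeries hc] at hv
  simpa [hz] using hv

end VerticalDerivative

/-! ### Sums over words -/

/-- Nonempty words are partitioned by their last letter into finitely many classes. -/
theorem hasSum_words {d : ℕ} {F : List (Fin d) → ℂ} {S : Fin d → ℂ}
    (h : ∀ k, HasSum (fun w => F (w ++ [k])) (S k)) : HasSum F (F [] + ∑ k, S k) := by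
  classical
  have hk : ∀ k ∈ Finset.univ, HasSum (fun w => if w.getLast? = some k then F w else 0) (S k) := by
    intro k _
    have hinj : Function.Injective fun w : List (Fin d) => w ++ [k] :=
      List.append_left_injective [k]
    rw [← hinj.hasSum_iff]
    · refine (h k).congr_fun ?_
      simp
    · intro w hw
      rcases List.eq_nil_or_concat w with rfl | ⟨p, j, rfl⟩
      · simp
      · have hj : j ≠ k := fun hj => hw ⟨p, by simp [hj]⟩
        simp [hj]
  refine ((hasSum_ite_eq [] (F [])).add (hasSum_sum hk)).congr_fun fun w => ?_
  rcases List.eq_nil_or_concat w with rfl | ⟨p, j, rfl⟩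
  · simp
  · simp

theorem splits_nodup {d : ℕ} (i : Fin d) (w : List (Fin d)) : (splits i w).Nodup := by
  induction w with
  | nil => simp [splits]
  | cons k w ih =>
    rw [splits, List.nodup_append]
    refine ⟨by split_ifs <;> simp, ih.map fun p q h => ?_, ?_⟩
    · obtain ⟨h1, h2⟩ := Prod.mk.inj h
      exact Prod.ext (List.cons.inj h1).2 h2
    · intro x hx y hy hxy
      subst hxy
      split_ifs at hx with hk
      · rw [List.mem_singleton] at hx
        obtain ⟨p, _, rfl⟩ := List.mem_map.1 hy
        simp at hx
      · simp at hx

/-- The map (p, q) ↦ pkq has exactly the pairs in `splits k w` as its fibre over w, without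
repetition; the series is regrouped along these fibres. -/
theorem hasSum_splits {d : ℕ} (k : Fin d) {G : List (Fin d) × List (Fin d) → ℂ} {S : ℂ}
    (h : HasSum G S) : HasSum (fun w => ((splits k w).map G).sum) S := by
  classical
  set φ : List (Fin d) × List (Fin d) → List (Fin d) := fun p => p.1 ++ k :: p.2
  have h1 := (Equiv.sigmaFiberEquiv φ).hasSum_iff.2 h
  refine h1.sigma fun w => ?_
  have e : ((splits k w).map G).sum = ∑ p ∈ (splits k w).toFinset, G p :=
    (List.sum_toFinset G (splits_nodup k w)).symm
  rw [e]
  have hs : {p | φ p = w} = ((splits k w).toFinset : Set (List (Fin d) × List (Fin d))) := by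
    ext p
    simp only [mem_ofPred_eq, List.coe_toFinset, mem_splits]
    exact eq_comm
  have h2 := hasSum_subtype_iff_indicator.1 ((splits k w).toFinset.hasSum G)
  rw [← hs] at h2
  exact hasSum_subtype_iff_indicator.2 h2

/-! ### The Schwinger-Dyson map on coefficients -/

section SchwingerDyson

variable {d m : ℕ}

/-- The quadratic part of the Schwinger-Dyson equation. -/
def sdQuad (a : List (Fin d) → ℂ) (k : Fin d) (w : List (Fin d)) : ℂ :=
  ((splits k w).map fun p => a p.1 * a p.2).sum

/-- The part of the Schwinger-Dyson equation that comes from the perturbation. -/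
def sdLin (v : Fin m → List (Fin d)) (g : Fin m → ℂ) (a : List (Fin d) → ℂ) (k : Fin d)
    (w : List (Fin d)) : ℂ :=
  ∑ j, g j * ((cyclicWords k (v j)).map fun z => a (w ++ z)).sum

/-- The map whose fixed points are the solutions of the Schwinger-Dyson equation. -/
def sdMap (v : Fin m → List (Fin d)) (g : Fin m → ℂ) (a : List (Fin d) → ℂ)
    (w : List (Fin d)) : ℂ :=
  match w.reverse with
  | [] => 1
  | k :: r => sdQuad a k r.reverse - sdLin v g a k r.reverse

variable (v : Fin m → List (Fin d)) (g : Fin m → ℂ) (a : List (Fin d) → ℂ)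

theorem sdMap_nil : sdMap v g a [] = 1 := rfl

theorem sdMap_append (w : List (Fin d)) (k : Fin d) :
    sdMap v g a (w ++ [k]) = sdQuad a k w - sdLin v g a k w := by
  simp [sdMap]

theorem length_of_mem_splits {k : Fin d} {w : List (Fin d)} {p : List (Fin d) × List (Fin d)}
    (hp : p ∈ splits k w) : p.1.length + p.2.length + 1 = w.length := by
  rw [(mem_splits k w p).1 hp]
  simp
  omega

theorem length_splits_le (k : Fin d) (w : List (Fin d)) : (splits k w).length ≤ w.length := by
  induction w with
  | nil => simp [splits]
  | cons j w ih =>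
    simp only [splits, List.length_append, List.length_map, List.length_cons]
    split_ifs <;> simp <;> omega

theorem length_of_mem_cyclicWords {k : Fin d} {w z : List (Fin d)}
    (hz : z ∈ cyclicWords k w) : z.length + 1 = w.length := by
  obtain ⟨p, hp, rfl⟩ := List.mem_map.1 hz
  have := length_of_mem_splits hp
  simp
  omega

theorem norm_sum_map_le {ι : Type*} (L : List ι) (f : ι → ℂ) {B : ℝ}
    (h : ∀ i ∈ L, ‖f i‖ ≤ B) : ‖(L.map f).sum‖ ≤ L.length * B := by
  induction L with
  | nil => simp
  | cons i L ih =>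
    simp only [List.map_cons, List.sum_cons, List.length_cons]
    push_cast
    have h1 := h i List.mem_cons_self
    have h2 := ih fun j hj => h j (List.mem_cons_of_mem _ hj)
    calc ‖f i + (L.map f).sum‖ ≤ B + L.length * B := (norm_add_le _ _).trans (add_le_add h1 h2)
      _ = _ := by ring

variable {a}

theorem ExpBounded.sdQuad (ha : ExpBounded a) (k : Fin d) : ExpBounded (sdQuad a k) := by
  obtain ⟨K, M, hK, hM, h⟩ := ha
  -- The factor 2 absorbs the number of splits, at most |w| ≤ 2^{|w|}. The maximum with 1 is needed
  -- because the two parts have total length |w| - 1, and the exponent is raised to |w|.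
  refine ⟨K * K, 2 * max M 1, by positivity, by positivity, fun w => ?_⟩
  have h1 : ∀ p ∈ splits k w, ‖a p.1 * a p.2‖ ≤ K * K * max M 1 ^ w.length := by
    intro p hp
    rw [norm_mul]
    calc ‖a p.1‖ * ‖a p.2‖ ≤ (K * M ^ p.1.length) * (K * M ^ p.2.length) := by
          gcongr
          · exact h _
          · exact h _
      _ ≤ (K * max M 1 ^ p.1.length) * (K * max M 1 ^ p.2.length) := by
          gcongr
          · exact le_max_left _ _
          · exact le_max_left _ _
      _ = K * K * max M 1 ^ (p.1.length + p.2.length) := by rw [pow_add]; ring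
      _ ≤ _ := by
          refine mul_le_mul_of_nonneg_left (pow_le_pow_right₀ (le_max_right _ _) ?_)
            (by positivity)
          have := length_of_mem_splits hp
          omega
  refine (norm_sum_map_le _ _ h1).trans ?_
  have h2 : ((splits k w).length : ℝ) ≤ 2 ^ w.length := by
    exact_mod_cast (length_splits_le k w).trans Nat.lt_two_pow_self.le
  calc ((splits k w).length : ℝ) * (K * K * max M 1 ^ w.length)
      ≤ 2 ^ w.length * (K * K * max M 1 ^ w.length) := by gcongr
    _ = _ := by rw [mul_pow]; ring

theorem ExpBounded.sdLin (ha : ExpBounded a) (k : Fin d) : ExpBounded (sdLin v g a k) :=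
  ExpBounded.finset_sum _ fun j _ =>
    (ExpBounded.list_sum (cyclicWords k (v j)) fun z => ha.append z).const_mul (g j)

theorem ExpBounded.sdMap (ha : ExpBounded a) : ExpBounded (sdMap v g a) := by
  have h := fun k => (ha.sdQuad k).sub (ExpBounded.sdLin v g ha k)
  choose K M hK hM hb using h
  -- Summing over letters gives constants valid for every last letter; the added 1 covers the empty
  -- word and keeps the base at least 1, so that the exponent may grow.
  refine ⟨1 + ∑ k, K k, 1 + ∑ k, M k, add_nonneg zero_le_one (Finset.sum_nonneg fun k _ => hK k),
    add_nonneg zero_le_one (Finset.sum_nonneg fun k _ => hM k), fun w => ?_⟩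
  have hKs := Finset.sum_nonneg fun k (_ : k ∈ Finset.univ) => hK k
  have hMs := Finset.sum_nonneg fun k (_ : k ∈ Finset.univ) => hM k
  rcases List.eq_nil_or_concat w with rfl | ⟨p, k, rfl⟩
  · simp [sdMap_nil, hKs]
  · rw [List.concat_eq_append, sdMap_append]
    have h1 : K k ≤ 1 + ∑ k, K k :=
      (Finset.single_le_sum (fun j _ => hK j) (Finset.mem_univ k)).trans (by linarith)
    have h2 : M k ≤ 1 + ∑ k, M k :=
      (Finset.single_le_sum (fun j _ => hM j) (Finset.mem_univ k)).trans (by linarith)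
    refine (hb k p).trans ?_
    refine mul_le_mul h1 ?_ (pow_nonneg (hM k) _) (by positivity)
    refine (pow_le_pow_left₀ (hM k) h2 _).trans (pow_le_pow_right₀ (by linarith) ?_)
    simp

end SchwingerDyson

/-! ### Expansion of the path loop equation -/

section LoopEquation

variable {d m : ℕ} {T : ℝ}

theorem BVPath.continuous_sig (γ : BVPath d T) (w : List (Fin d)) (s : ℝ) :
    Continuous (γ.sig w s) := γ.continuous_sigRev s w.reverse

theorem BVPath.measurable_sig_left (γ : BVPath d T) (w : List (Fin d)) (t : ℝ) :
    Measurable fun u => γ.sig w u t :=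
  (γ.measurable_sigRev w.reverse).comp (measurable_id.prodMk measurable_const)

theorem hasSum_integral_pathSeries {b : List (Fin d) → ℂ} (hb : ExpBounded b)
    (γ : BVPath d T) (k : Fin d) {s t : ℝ} (hst : s ≤ t) :
    HasSum (fun w => b w * (γ.sig (w ++ [k]) s t : ℂ))
      (γ.integral k s t fun u => pathSeries b γ s u) := by
  have h := γ.hasSum_integral k (s := s) (t := t)
    (f := fun w u => b w * (γ.sig w s u : ℂ)) (g := fun u => pathSeries b γ s u)
    (hb.summable_mul (γ.controlOn_nonneg hst))
    (fun w => ((Complex.measurable_ofReal.comp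
      (γ.continuous_sig w s).measurable).const_mul _).aestronglyMeasurable)
    (fun w u hu => norm_mul_sig_le b γ le_rfl hu.1.le hu.2 w)
    (fun u hu => hasSum_pathSeries hb γ hu.1.le)
  refine h.congr_fun fun w => ?_
  rw [γ.integral_const_mul, γ.integral_ofReal, γ.sig_append_singleton]

theorem summable_mul_words {b : List (Fin d) → ℂ} (hb : ExpBounded b) {V : ℝ} (hV : 0 ≤ V) :
    Summable fun p : List (Fin d) × List (Fin d) =>
      (‖b p.1‖ * (V ^ p.1.length / p.1.length.factorial)) *
        (‖b p.2‖ * (V ^ p.2.length / p.2.length.factorial)) :=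
  (hb.summable_mul hV).mul_of_nonneg (hb.summable_mul hV) (fun _ => by positivity)
    (fun _ => by positivity)

theorem hasSum_mul_of_summable_norm {ι κ : Type*} {f : ι → ℂ} {g : κ → ℂ} {x y : ℂ}
    (hf : HasSum f x) (hg : HasSum g y) (hf' : Summable fun i => ‖f i‖)
    (hg' : Summable fun j => ‖g j‖) : HasSum (fun p : ι × κ => f p.1 * g p.2) (x * y) :=
  hf.mul hg (summable_mul_of_summable_norm hf' hg')

/-- The product of two absolutely convergent series is a series over pairs (p, q), and integrating
the product of signature terms over the separating time inserts k between p and q. -/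
theorem hasSum_integral_mul_pathSeries {b : List (Fin d) → ℂ} (hb : ExpBounded b)
    (γ : BVPath d T) (k : Fin d) {s r : ℝ} (hsr : s ≤ r) :
    HasSum (fun p : List (Fin d) × List (Fin d) =>
        b p.1 * b p.2 * (γ.sig (p.1 ++ k :: p.2) s r : ℂ))
      (γ.integral k s r fun u => pathSeries b γ s u * pathSeries b γ u r) := by
  have hsum : ∀ u ∈ Ioc s r, HasSum (fun p : List (Fin d) × List (Fin d) =>
      (b p.1 * (γ.sig p.1 s u : ℂ)) * (b p.2 * (γ.sig p.2 u r : ℂ)))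
      (pathSeries b γ s u * pathSeries b γ u r) := fun u hu => by
    have hsu : s ≤ u := hu.1.le
    have hur : u ≤ r := hu.2
    exact hasSum_mul_of_summable_norm (f := fun w => b w * (γ.sig w s u : ℂ))
      (g := fun w => b w * (γ.sig w u r : ℂ)) (hasSum_pathSeries hb γ hsu)
      (hasSum_pathSeries hb γ hur) (summable_norm_pathSeries hb γ hsu)
      (summable_norm_pathSeries hb γ hur)
  have h := γ.hasSum_integral k (s := s) (t := r)
    (f := fun (p : List (Fin d) × List (Fin d)) u =>
      (b p.1 * (γ.sig p.1 s u : ℂ)) * (b p.2 * (γ.sig p.2 u r : ℂ)))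
    (g := fun u => pathSeries b γ s u * pathSeries b γ u r)
    (summable_mul_words hb (γ.controlOn_nonneg hsr))
    (fun p => (((Complex.measurable_ofReal.comp
        (γ.continuous_sig p.1 s).measurable).const_mul _).mul
      ((Complex.measurable_ofReal.comp
        (γ.measurable_sig_left p.2 r)).const_mul _)).aestronglyMeasurable)
    (fun p u hu => by
      rw [norm_mul]
      exact mul_le_mul (norm_mul_sig_le b γ le_rfl hu.1.le hu.2 p.1)
        (norm_mul_sig_le b γ hu.1.le hu.2 le_rfl p.2) (norm_nonneg _)
        (mul_nonneg (norm_nonneg _) (div_nonneg (pow_nonneg (γ.controlOn_nonneg hsr) _)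
          (Nat.cast_nonneg _))))
    hsum
  refine h.congr_fun fun p => ?_
  have e : (fun u => (b p.1 * (γ.sig p.1 s u : ℂ)) * (b p.2 * (γ.sig p.2 u r : ℂ))) =
      fun u => b p.1 * b p.2 *
        ((γ.sigRev s p.1.reverse u * γ.sigRev u p.2.reverse r : ℝ) : ℂ) := by
    ext u
    simp only [BVPath.sig]
    push_cast
    ring
  rw [e, γ.integral_const_mul, γ.integral_ofReal, γ.integral_sigRev_mul_sigRev]
  simp [BVPath.sig]

/-- Since |p|! |q|! divides (|p| + |q|)!, the decay factorises over p and q. This yields a summable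
majorant for the double series. -/
theorem BVPath.abs_sig_insert_le (γ : BVPath d T) {s r t : ℝ} (hsr : s ≤ r) (hrt : r ≤ t)
    (k : Fin d) (p q : List (Fin d)) : |γ.sig (p ++ k :: q) s r| ≤ γ.controlOn s t *
      ((γ.controlOn s t ^ p.length / p.length.factorial) *
        (γ.controlOn s t ^ q.length / q.length.factorial)) := by
  have hV := γ.controlOn_nonneg (hsr.trans hrt)
  refine (γ.abs_sig_le le_rfl hsr hrt _).trans ?_
  have hl : (p ++ k :: q).length = p.length + q.length + 1 := by simp; omega
  have hf : (p.length.factorial * q.length.factorial : ℝ) ≤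
      ((p.length + q.length + 1).factorial : ℝ) := by
    exact_mod_cast (Nat.le_of_dvd (Nat.factorial_pos _)
      (Nat.factorial_mul_factorial_dvd_factorial_add _ _)).trans
      (Nat.factorial_le (Nat.le_succ _))
  rw [hl]
  calc γ.controlOn s t ^ (p.length + q.length + 1) / (p.length + q.length + 1).factorial
      ≤ γ.controlOn s t ^ (p.length + q.length + 1) /
          (p.length.factorial * q.length.factorial) := by gcongr
    _ = _ := by
        rw [pow_succ, pow_add]
        field_simp

/-- The outer integral appends k to pkq. Collecting the pairs that give the same word w = pkq
produces `sdQuad`. -/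
theorem hasSum_integral_integral_pathSeries {b : List (Fin d) → ℂ} (hb : ExpBounded b)
    (γ : BVPath d T) (k : Fin d) {s t : ℝ} (hst : s ≤ t) :
    HasSum (fun w => sdQuad b k w * (γ.sig (w ++ [k]) s t : ℂ))
      (γ.integral k s t fun r => γ.integral k s r fun u =>
        pathSeries b γ s u * pathSeries b γ u r) := by
  have h := γ.hasSum_integral k (s := s) (t := t)
    (f := fun (p : List (Fin d) × List (Fin d)) r =>
      b p.1 * b p.2 * (γ.sig (p.1 ++ k :: p.2) s r : ℂ))
    (g := fun r => γ.integral k s r fun u => pathSeries b γ s u * pathSeries b γ u r)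
    ((summable_mul_words hb (γ.controlOn_nonneg hst)).mul_left (γ.controlOn s t))
    (fun p => ((Complex.measurable_ofReal.comp
      (γ.continuous_sig _ s).measurable).const_mul _).aestronglyMeasurable)
    (fun p r hr => by
      rw [norm_mul, norm_mul, Complex.norm_real]
      refine (mul_le_mul_of_nonneg_left (γ.abs_sig_insert_le hr.1.le hr.2 k p.1 p.2)
        (by positivity)).trans (le_of_eq ?_)
      ring)
    (fun r hr => hasSum_integral_mul_pathSeries hb γ k hr.1.le)
  refine (hasSum_splits k h).congr_fun fun w => ?_
  rw [sdQuad, ← List.sum_map_mul_right]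
  congr 1
  refine List.map_congr_left fun p hp => ?_
  rw [γ.integral_const_mul, γ.integral_ofReal, ← γ.sig_append_singleton,
    ← (mem_splits k w p).1 hp]

/-- A split loses one letter, and i^{|w|-1} = -i^{|w|+1}. This sign cancels the minus in front of
the double integral. -/
theorem sdQuad_I_pow_mul (a : List (Fin d) → ℂ) (k : Fin d) (w : List (Fin d)) :
    sdQuad (fun w => Complex.I ^ w.length * a w) k w =
      -(Complex.I ^ (w.length + 1) * sdQuad a k w) := by
  rw [sdQuad, sdQuad, ← neg_mul, ← List.sum_map_mul_left]
  congr 1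
  refine List.map_congr_left fun p hp => ?_
  rw [← length_of_mem_splits hp]
  linear_combination ((Complex.I ^ p.1.length * Complex.I ^ p.2.length * a p.1 * a p.2)) *
    Complex.I_sq

section

variable [hT : Fact (0 < T)]

/-- Each z in D_k v_j has length |v_j| - 1, so (-i)^{|z|} cancels the i^{|z|} coming from the shift
by z. The remaining -(-i) = i raises the power to i^{|w|+1}. -/
theorem loopOperator_sigFunctional (v : Fin m → List (Fin d)) (g : Fin m → ℂ)
    {a : List (Fin d) → ℂ} (ha : ExpBounded a) (γ : BVPath d T) (k : Fin d) {s u : ℝ}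
    (hsu : s ≤ u) :
    loopOperator v g k (fun η : BVPath d T => sigFunctional a η 0 T) (γ.segment s u) =
      pathSeries (fun w => Complex.I ^ (w.length + 1) * sdLin v g a k w) γ s u := by
  have hc := ha.I_pow_mul
  simp only [loopOperator, sigFunctional_eq_pathSeries, verticalDerivWord_pathSeries hc,
    pathSeries_segment _ γ hsu]
  have e : ∀ j, (-Complex.I) ^ (v j).length * g j * ((cyclicWords k (v j)).map fun z =>
      pathSeries (fun w => Complex.I ^ (w ++ z).length * a (w ++ z)) γ s u).sum =
      pathSeries (fun w => (-Complex.I) ^ (v j).length * g j * ((cyclicWords k (v j)).map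
        fun z => Complex.I ^ (w ++ z).length * a (w ++ z)).sum) γ s u := fun j => by
    rw [pathSeries_const_mul, pathSeries_list_sum _ (fun z => hc.append z) γ hsu]
  simp only [e]
  rw [← pathSeries_finset_sum _ (fun j _ =>
    (ExpBounded.list_sum _ fun z => hc.append z).const_mul _) γ hsu, ← neg_one_mul,
    ← pathSeries_const_mul]
  congr 1
  ext w
  rw [sdLin, Finset.mul_sum, Finset.mul_sum]
  refine Finset.sum_congr rfl fun j _ => ?_
  simp only [← List.sum_map_mul_left]
  congr 1
  refine List.map_congr_left fun z hz => ?_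
  rw [← length_of_mem_cyclicWords hz, List.length_append]
  have h1 : (-Complex.I) ^ z.length * Complex.I ^ z.length = 1 := by
    rw [← mul_pow]
    simp
  linear_combination (Complex.I * g j * Complex.I ^ w.length * a (w ++ z)) * h1

/-- The leading 1 is the empty word. Both integrals contribute only words wk, with the common factor
i^{|w|+1} belonging to the length of wk. -/
theorem loop_rhs_eq_sigFunctional (v : Fin m → List (Fin d)) (g : Fin m → ℂ)
    {a : List (Fin d) → ℂ} (ha : ExpBounded a) (γ : BVPath d T) {s t : ℝ} (hst : s ≤ t) :
    1 - ∑ k : Fin d, γ.integral k s t (fun r => γ.integral k s r (fun u =>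
          sigFunctional a γ s u * sigFunctional a γ u r))
      - ∑ k : Fin d, γ.integral k s t (fun u =>
          loopOperator v g k (fun η : BVPath d T => sigFunctional a η 0 T) (γ.segment s u)) =
      sigFunctional (sdMap v g a) γ s t := by
  have hc := ha.I_pow_mul
  have e2 : ∀ k, γ.integral k s t (fun u =>
      loopOperator v g k (fun η : BVPath d T => sigFunctional a η 0 T) (γ.segment s u)) =
      γ.integral k s t (fun u =>
        pathSeries (fun w => Complex.I ^ (w.length + 1) * sdLin v g a k w) γ s u) := fun k =>
    γ.integral_congr k fun u hu => loopOperator_sigFunctional v g ha γ k hu.1.le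
  have hl : ∀ k, ExpBounded fun w => Complex.I ^ (w.length + 1) * sdLin v g a k w := fun k => by
    refine ((ExpBounded.sdLin v g ha k).I_pow_mul.const_mul Complex.I).congr fun w => ?_
    rw [pow_succ]
    ring
  have hk : ∀ k, HasSum (fun w => Complex.I ^ (w ++ [k]).length * sdMap v g a (w ++ [k]) *
      (γ.sig (w ++ [k]) s t : ℂ))
      (-(γ.integral k s t fun r => γ.integral k s r fun u =>
          sigFunctional a γ s u * sigFunctional a γ u r) -
        γ.integral k s t (fun u =>
          pathSeries (fun w => Complex.I ^ (w.length + 1) * sdLin v g a k w) γ s u)) := by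
    intro k
    refine ((hasSum_integral_integral_pathSeries hc γ k hst).neg.sub
      (hasSum_integral_pathSeries (hl k) γ k hst)).congr_fun fun w => ?_
    rw [sdMap_append, sdQuad_I_pow_mul, List.length_append, List.length_singleton]
    ring
  have h := hasSum_words (F := fun w => Complex.I ^ w.length * sdMap v g a w *
    (γ.sig w s t : ℂ)) hk
  simp only [e2]
  rw [sigFunctional, h.tsum_eq]
  simp only [sdMap_nil, BVPath.sig_nil, Finset.sum_sub_distrib, Finset.sum_neg_distrib]
  simp
  ring

theorem satisfiesLoopEquation_iff (v : Fin m → List (Fin d)) (g : Fin m → ℂ)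
    {a : List (Fin d) → ℂ} (ha : ExpBounded a) :
    SatisfiesLoopEquation T v g a ↔ sdMap v g a = a := by
  constructor
  · intro h
    have h1 := eq_of_pathSeries_eq (T := T) ((ExpBounded.sdMap v g ha).I_pow_mul) ha.I_pow_mul
      fun γ => by
        have h2 := h γ 0 T le_rfl hT.out.le le_rfl
        rw [loop_rhs_eq_sigFunctional v g ha γ hT.out.le] at h2
        exact h2.symm
    ext w
    exact mul_left_cancel₀ (pow_ne_zero _ Complex.I_ne_zero) (congrFun h1 w)
  · intro h γ s t _ hst _
    rw [loop_rhs_eq_sigFunctional v g ha γ hst, h]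

end

end LoopEquation

/-! ### A weighted norm on coefficients -/

section WeightedNorm

open scoped ENNReal

variable {d m : ℕ}

/-- The largest coefficient of the words of length `n`. -/
def levelNorm (a : List (Fin d) → ℂ) (n : ℕ) : ℝ≥0∞ :=
  ⨆ w : {w : List (Fin d) // w.length = n}, ‖a w‖ₑ

/-- The weighted `ℓ¹`-norm of the largest coefficients of each length. -/
def weightedNorm (r : ℝ≥0∞) (a : List (Fin d) → ℂ) : ℝ≥0∞ := ∑' n, levelNorm a n * r ^ n

theorem enorm_le_levelNorm (a : List (Fin d) → ℂ) (w : List (Fin d)) :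
    ‖a w‖ₑ ≤ levelNorm a w.length :=
  le_iSup (fun w' : {w' : List (Fin d) // w'.length = w.length} => ‖a w'‖ₑ) ⟨w, rfl⟩

theorem levelNorm_le {a : List (Fin d) → ℂ} {n : ℕ} {B : ℝ≥0∞}
    (h : ∀ w, w.length = n → ‖a w‖ₑ ≤ B) : levelNorm a n ≤ B :=
  iSup_le fun w => h w w.2

theorem levelNorm_mul_pow_le (r : ℝ≥0∞) (a : List (Fin d) → ℂ) (n : ℕ) :
    levelNorm a n * r ^ n ≤ weightedNorm r a :=
  ENNReal.le_tsum n

theorem enorm_mul_pow_le (r : ℝ≥0∞) (a : List (Fin d) → ℂ) (w : List (Fin d)) :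
    ‖a w‖ₑ * r ^ w.length ≤ weightedNorm r a :=
  (mul_le_mul_left (enorm_le_levelNorm a w) _).trans (levelNorm_mul_pow_le r a _)

theorem weightedNorm_zero (r : ℝ≥0∞) :
    weightedNorm r (fun _ : List (Fin d) => (0 : ℂ)) = 0 := by
  simp [weightedNorm, levelNorm]

theorem weightedNorm_add_le (r : ℝ≥0∞) (a b : List (Fin d) → ℂ) :
    weightedNorm r (fun w => a w + b w) ≤ weightedNorm r a + weightedNorm r b := by
  rw [weightedNorm, weightedNorm, weightedNorm, ← ENNReal.tsum_add]
  refine ENNReal.tsum_le_tsum fun n => ?_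
  rw [← add_mul]
  refine mul_le_mul_left (levelNorm_le ?_) _
  rintro w rfl
  exact (enorm_add_le _ _).trans (add_le_add (enorm_le_levelNorm a w) (enorm_le_levelNorm b w))

theorem weightedNorm_sub_le (r : ℝ≥0∞) (a b : List (Fin d) → ℂ) :
    weightedNorm r (fun w => a w - b w) ≤ weightedNorm r a + weightedNorm r b := by
  have h : levelNorm (fun w => -b w) = levelNorm b := by
    ext n
    simp [levelNorm]
  have h2 := weightedNorm_add_le r a fun w => -b w
  rw [show weightedNorm r (fun w => -b w) = weightedNorm r b by rw [weightedNorm, h]; rfl] at h2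
  simpa only [sub_eq_add_neg] using h2

theorem tsum_mul_tsum_eq_tsum_antidiagonal (f g : ℕ → ℝ≥0∞) :
    (∑' i, f i) * ∑' j, g j = ∑' n, ∑ p ∈ Finset.HasAntidiagonal.antidiagonal n, f p.1 * g p.2 := by
  have h1 : ∀ n, ∑ p ∈ Finset.HasAntidiagonal.antidiagonal n, f p.1 * g p.2 =
      ∑' p : Finset.HasAntidiagonal.antidiagonal n, f p.1.1 * g p.1.2 := fun n =>
    (Finset.tsum_subtype (Finset.HasAntidiagonal.antidiagonal n) fun p => f p.1 * g p.2).symm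
  have h2 := (Finset.HasAntidiagonal.sigmaAntidiagonalEquivProd (A := ℕ)).tsum_eq
    fun p : ℕ × ℕ => f p.1 * g p.2
  rw [ENNReal.tsum_sigma', ENNReal.tsum_prod (f := fun i j => f i * g j)] at h2
  simp only [ENNReal.tsum_mul_left, ENNReal.tsum_mul_right] at h2
  simp only [h1]
  exact h2.symm

theorem enorm_list_sum_map_le {ι : Type*} (L : List ι) (f : ι → ℂ) :
    ‖(L.map f).sum‖ₑ ≤ (L.map fun i => ‖f i‖ₑ).sum := by
  induction L with
  | nil => simp
  | cons i L ih =>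
    simp only [List.map_cons, List.sum_cons]
    exact (enorm_add_le _ _).trans (add_le_add le_rfl ih)

theorem list_sum_map_le {ι : Type*} (L : List ι) {f g : ι → ℝ≥0∞} (h : ∀ i, f i ≤ g i) :
    (L.map f).sum ≤ (L.map g).sum := by
  induction L with
  | nil => simp
  | cons i L ih => simpa using add_le_add (h i) ih

/-- Different splits have left parts of different lengths, so each pair of lengths occurs at most
once. This keeps d out of the quadratic estimate. -/
theorem sum_splits_le (G : ℕ → ℕ → ℝ≥0∞) (k j : Fin d) (w : List (Fin d)) :
    ((splits k (j :: w)).map fun p => G p.1.length p.2.length).sum ≤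
      ∑ p ∈ Finset.HasAntidiagonal.antidiagonal w.length, G p.1 p.2 := by
  have hsplit : ∀ (G : ℕ → ℕ → ℝ≥0∞) (j : Fin d) (w : List (Fin d)),
      ((splits k (j :: w)).map fun p => G p.1.length p.2.length).sum ≤ G 0 w.length +
        ((splits k w).map fun p => G (p.1.length + 1) p.2.length).sum := by
    intro G j w
    simp only [splits, List.map_append, List.sum_append, List.map_map]
    refine add_le_add ?_ (le_of_eq rfl)
    split_ifs <;> simp
  induction w generalizing j G with
  | nil => simpa [splits] using hsplit G j []
  | cons i w ih =>
    rw [List.length_cons, Finset.Nat.sum_antidiagonal_succ]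
    exact (hsplit G j (i :: w)).trans (add_le_add le_rfl (ih (fun x y => G (x + 1) y) i))

theorem enorm_sum_splits_le (a b : List (Fin d) → ℂ) (k : Fin d) {n : ℕ} (w : List (Fin d))
    (hw : w.length = n + 1) :
    ‖((splits k w).map fun p => a p.1 * b p.2).sum‖ₑ ≤
      ∑ p ∈ Finset.HasAntidiagonal.antidiagonal n, levelNorm a p.1 * levelNorm b p.2 := by
  cases w with
  | nil => simp at hw
  | cons j w =>
    obtain rfl : w.length = n := by simpa using hw
    refine (enorm_list_sum_map_le _ _).trans (le_trans (list_sum_map_le _ fun p => ?_)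
      (sum_splits_le (fun x y => levelNorm a x * levelNorm b y) k j w))
    rw [enorm_mul]
    exact mul_le_mul' (enorm_le_levelNorm a _) (enorm_le_levelNorm b _)

theorem sdQuad_sub (a b : List (Fin d) → ℂ) (k : Fin d) (w : List (Fin d)) :
    sdQuad a k w - sdQuad b k w =
      ((splits k w).map fun p => (a p.1 - b p.1) * a p.2).sum +
        ((splits k w).map fun p => b p.1 * (a p.2 - b p.2)).sum := by
  simp only [sdQuad]
  induction splits k w with
  | nil => simp
  | cons p L ih =>
    simp only [List.map_cons, List.sum_cons]
    linear_combination ih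

theorem sdLin_sub (v : Fin m → List (Fin d)) (g : Fin m → ℂ) (a b : List (Fin d) → ℂ)
    (k : Fin d) (w : List (Fin d)) :
    sdLin v g a k w - sdLin v g b k w = sdLin v g (fun w => a w - b w) k w := by
  simp only [sdLin, ← Finset.sum_sub_distrib, ← mul_sub]
  refine Finset.sum_congr rfl fun j _ => ?_
  congr 1
  induction cyclicWords k (v j) with
  | nil => simp
  | cons p L ih =>
    simp only [List.map_cons, List.sum_cons]
    linear_combination ih

/-- The norm of the linear part of the Schwinger-Dyson map, up to the size of the couplings. -/
def sdLinConst (v : Fin m → List (Fin d)) (r s : ℝ≥0∞) : ℝ≥0∞ :=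
  ∑ k, ∑ j, ((cyclicWords k (v j)).map fun z => r * s ^ z.length).sum

/-- As rs = 1, the weight r^{n+1} equals r s^{|z|} r^{n+|z|}; the shifted sum over n is then part of
the full norm. -/
theorem sum_levelNorm_append_le {r s : ℝ≥0∞} (hrs : r * s = 1) (e : List (Fin d) → ℂ)
    (L : List (List (Fin d))) :
    ∑' n, (L.map fun z => levelNorm e (n + z.length)).sum * r ^ (n + 1) ≤
      (L.map fun z => r * s ^ z.length).sum * weightedNorm r e := by
  induction L with
  | nil => simp
  | cons z L ih =>
    simp only [List.map_cons, List.sum_cons, add_mul]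
    rw [ENNReal.tsum_add]
    refine add_le_add ?_ ih
    have h1 : ∀ n, levelNorm e (n + z.length) * r ^ (n + 1) =
        r * s ^ z.length * (levelNorm e (n + z.length) * r ^ (n + z.length)) := fun n => by
      have h2 : (r * s) ^ z.length = 1 := by rw [hrs, one_pow]
      calc levelNorm e (n + z.length) * r ^ (n + 1)
          = levelNorm e (n + z.length) * r ^ (n + 1) * (r * s) ^ z.length := by rw [h2, mul_one]
        _ = _ := by ring
    simp only [h1]
    rw [ENNReal.tsum_mul_left]
    refine mul_le_mul_right ?_ _
    exact ENNReal.tsum_comp_le_tsum_of_injective (add_left_injective z.length)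
      fun n => levelNorm e n * r ^ n

theorem le_fintype_sum {ι : Type*} [Fintype ι] (f : ι → ℝ≥0∞) (k : ι) : f k ≤ ∑ i, f i := by
  rw [← tsum_fintype (L := .unconditional _)]
  exact ENNReal.le_tsum k

theorem enorm_sdLin_le (v : Fin m → List (Fin d)) (g : Fin m → ℂ) {ε : ℝ≥0∞}
    (hg : ∀ j, ‖g j‖ₑ ≤ ε) (e : List (Fin d) → ℂ) (k : Fin d) (w : List (Fin d)) :
    ‖sdLin v g e k w‖ₑ ≤ ε * ∑ k, ∑ j, ((cyclicWords k (v j)).map fun z =>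
      levelNorm e (w.length + z.length)).sum := by
  set f : Fin d → ℝ≥0∞ := fun k => ∑ j, ((cyclicWords k (v j)).map fun z =>
    levelNorm e (w.length + z.length)).sum with hf
  have h1 : f k ≤ ∑ k, f k := le_fintype_sum f k
  refine le_trans ?_ (mul_le_mul_right h1 ε)
  rw [hf, Finset.mul_sum]
  refine (enorm_sum_le _ _).trans (Finset.sum_le_sum fun j _ => ?_)
  rw [enorm_mul]
  refine mul_le_mul' (hg j) ((enorm_list_sum_map_le _ _).trans (list_sum_map_le _ fun z => ?_))
  rw [← List.length_append]
  exact enorm_le_levelNorm e _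

/-- A word pkq followed by its last letter has length |p| + |q| + 2, so the quadratic part is r²
times a Cauchy product. The difference of the quadratic terms is polarised as (a - b)a + b(a - b).
-/
theorem weightedNorm_sdMap_sub_le (v : Fin m → List (Fin d)) (g : Fin m → ℂ) {ε r s : ℝ≥0∞}
    (hg : ∀ j, ‖g j‖ₑ ≤ ε) (hrs : r * s = 1) (a b : List (Fin d) → ℂ) :
    weightedNorm r (fun w => sdMap v g a w - sdMap v g b w) ≤
      (r ^ 2 * (weightedNorm r a + weightedNorm r b) + ε * sdLinConst v r s) *
        weightedNorm r (fun w => a w - b w) := by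
  set e : List (Fin d) → ℂ := fun w => a w - b w with he
  set A : ℕ → ℝ≥0∞ := fun n => ∑ p ∈ Finset.HasAntidiagonal.antidiagonal n, levelNorm e p.1 * levelNorm a p.2
  set B : ℕ → ℝ≥0∞ := fun n => ∑ p ∈ Finset.HasAntidiagonal.antidiagonal n, levelNorm b p.1 * levelNorm e p.2
  -- The index is the length without the last letter; at 0 nothing can be split, and at n + 1 the
  -- two parts have total length n.
  set Q : ℕ → ℝ≥0∞ := fun n => match n with
    | 0 => 0
    | n + 1 => A n + B n with hQ
  set Λ : ℕ → ℝ≥0∞ := fun n => ∑ k, ∑ j, ((cyclicWords k (v j)).map fun z =>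
    levelNorm e (n + z.length)).sum with hΛ
  have hlev : ∀ n, levelNorm (fun w => sdMap v g a w - sdMap v g b w) (n + 1) ≤
      Q n + ε * Λ n := by
    intro n
    refine levelNorm_le fun w hw => ?_
    rcases List.eq_nil_or_concat w with rfl | ⟨p, k, rfl⟩
    · simp at hw
    rw [List.concat_eq_append] at hw ⊢
    have hp : p.length = n := by simpa using hw
    rw [sdMap_append, sdMap_append]
    have e1 : sdQuad a k p - sdLin v g a k p - (sdQuad b k p - sdLin v g b k p) =
        (sdQuad a k p - sdQuad b k p) - sdLin v g e k p := by
      rw [← sdLin_sub]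
      ring
    rw [e1, sub_eq_add_neg]
    refine (enorm_add_le _ _).trans ?_
    rw [enorm_neg]
    refine add_le_add ?_ ?_
    · rw [sdQuad_sub]
      cases n with
      | zero =>
        obtain rfl := List.length_eq_zero_iff.1 hp
        simp [splits]
      | succ n =>
        exact (enorm_add_le _ _).trans (add_le_add (enorm_sum_splits_le e a k p hp)
          (enorm_sum_splits_le b e k p hp))
    · rw [← hp]
      exact enorm_sdLin_le v g hg e k p
  have h0 : levelNorm (fun w => sdMap v g a w - sdMap v g b w) 0 = 0 := by
    refine le_antisymm (levelNorm_le fun w hw => ?_) zero_le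
    obtain rfl := List.length_eq_zero_iff.1 hw
    simp [sdMap_nil]
  have hA : ∑' n, A n * r ^ n = weightedNorm r e * weightedNorm r a := by
    rw [weightedNorm, weightedNorm, tsum_mul_tsum_eq_tsum_antidiagonal]
    refine tsum_congr fun n => ?_
    rw [Finset.sum_mul]
    refine Finset.sum_congr rfl fun p hp => ?_
    rw [← Finset.HasAntidiagonal.mem_antidiagonal.1 hp, pow_add]
    ring
  have hB : ∑' n, B n * r ^ n = weightedNorm r b * weightedNorm r e := by
    rw [weightedNorm, weightedNorm, tsum_mul_tsum_eq_tsum_antidiagonal]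
    refine tsum_congr fun n => ?_
    rw [Finset.sum_mul]
    refine Finset.sum_congr rfl fun p hp => ?_
    rw [← Finset.HasAntidiagonal.mem_antidiagonal.1 hp, pow_add]
    ring
  have hQs : ∑' n, Q n * r ^ (n + 1) =
      r ^ 2 * (weightedNorm r a + weightedNorm r b) * weightedNorm r e := by
    rw [tsum_eq_zero_add' ENNReal.summable]
    have h1 : ∀ n, Q (n + 1) * r ^ (n + 1 + 1) = r ^ 2 * (A n * r ^ n + B n * r ^ n) := fun n => by
      simp only [hQ]
      ring
    simp only [h1]
    rw [ENNReal.tsum_mul_left, ENNReal.tsum_add, hA, hB]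
    simp only [hQ, zero_mul, zero_add]
    ring
  have hΛs : ∑' n, Λ n * r ^ (n + 1) ≤ sdLinConst v r s * weightedNorm r e := by
    simp only [hΛ, Finset.sum_mul, sdLinConst]
    rw [Summable.tsum_finsetSum fun _ _ => ENNReal.summable]
    refine Finset.sum_le_sum fun k _ => ?_
    rw [Summable.tsum_finsetSum fun _ _ => ENNReal.summable]
    exact Finset.sum_le_sum fun j _ => sum_levelNorm_append_le hrs e _
  rw [weightedNorm, tsum_eq_zero_add' ENNReal.summable, h0, zero_mul, zero_add]
  calc ∑' n, levelNorm (fun w => sdMap v g a w - sdMap v g b w) (n + 1) * r ^ (n + 1)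
      ≤ ∑' n, (Q n * r ^ (n + 1) + ε * (Λ n * r ^ (n + 1))) := by
        refine ENNReal.tsum_le_tsum fun n => (mul_le_mul_left (hlev n) _).trans (le_of_eq ?_)
        ring
    _ ≤ r ^ 2 * (weightedNorm r a + weightedNorm r b) * weightedNorm r e +
          ε * (sdLinConst v r s * weightedNorm r e) := by
        rw [ENNReal.tsum_add, ENNReal.tsum_mul_left, hQs]
        gcongr
    _ = _ := by ring

/-- Comparison with the zero coefficients, whose image is the indicator of the empty word and has
norm at most 1. -/
theorem weightedNorm_sdMap_le (v : Fin m → List (Fin d)) (g : Fin m → ℂ) {ε r s : ℝ≥0∞}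
    (hg : ∀ j, ‖g j‖ₑ ≤ ε) (hrs : r * s = 1) (a : List (Fin d) → ℂ) :
    weightedNorm r (sdMap v g a) ≤
      1 + (r ^ 2 * weightedNorm r a + ε * sdLinConst v r s) * weightedNorm r a := by
  have h1 := weightedNorm_sdMap_sub_le v g hg hrs a fun _ => 0
  simp only [weightedNorm_zero, add_zero, sub_zero] at h1
  have h2 : weightedNorm r (sdMap v g fun _ => 0) ≤ 1 := by
    rw [weightedNorm, tsum_eq_single 0]
    · rw [pow_zero, mul_one]
      refine levelNorm_le fun w hw => ?_
      obtain rfl := List.length_eq_zero_iff.1 hw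
      simp [sdMap_nil]
    · intro n hn
      have : levelNorm (sdMap v g fun _ => 0) n ≤ 0 := by
        refine levelNorm_le fun w hw => ?_
        rcases List.eq_nil_or_concat w with rfl | ⟨p, k, rfl⟩
        · exact absurd hw.symm hn
        · rw [List.concat_eq_append, sdMap_append]
          simp [sdQuad, sdLin]
      rw [le_antisymm this zero_le, zero_mul]
  have h3 := weightedNorm_add_le r (sdMap v g fun _ => 0)
    fun w => sdMap v g a w - sdMap v g (fun _ => 0) w
  simp only [add_sub_cancel] at h3
  exact h3.trans (add_le_add h2 h1)

/-- The Schwinger-Dyson map is a contraction of the ball of radius `2`. -/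
structure SDContraction (v : Fin m → List (Fin d)) (ε r s : ℝ≥0∞) : Prop where
  mul_eq_one : r * s = 1
  sq_lt : 4 * r ^ 2 < 1
  le_one : 4 * r ^ 2 + 2 * (ε * sdLinConst v r s) ≤ 1

namespace SDContraction

variable {v : Fin m → List (Fin d)} {ε r s : ℝ≥0∞} {g : Fin m → ℂ} {a b : List (Fin d) → ℂ}

/-- Twice the factor is the sum of `4 * r ^ 2`, which is strictly below 1, and the quantity in
`le_one`. -/
theorem factor_lt_one (h : SDContraction v ε r s) :
    4 * r ^ 2 + ε * sdLinConst v r s < 1 := by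
  by_contra hq
  rw [not_lt] at hq
  have h1 : (2 : ℝ≥0∞) ≤ 4 * r ^ 2 + (4 * r ^ 2 + 2 * (ε * sdLinConst v r s)) := by
    calc (2 : ℝ≥0∞) = 2 * 1 := by norm_num
      _ ≤ 2 * (4 * r ^ 2 + ε * sdLinConst v r s) := mul_le_mul_right hq _
      _ = _ := by ring
  have h2 : 4 * r ^ 2 + (4 * r ^ 2 + 2 * (ε * sdLinConst v r s)) < 1 + 1 :=
    ENNReal.add_lt_add_of_lt_of_le (ne_top_of_le_ne_top ENNReal.one_ne_top h.le_one)
      h.sq_lt h.le_one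
  rw [one_add_one_eq_two] at h2
  exact absurd h1 (not_le.2 h2)

theorem norm_sub_le (h : SDContraction v ε r s) (hg : ∀ j, ‖g j‖ₑ ≤ ε)
    (ha : weightedNorm r a ≤ 2) (hb : weightedNorm r b ≤ 2) :
    weightedNorm r (fun w => sdMap v g a w - sdMap v g b w) ≤
      (4 * r ^ 2 + ε * sdLinConst v r s) * weightedNorm r (fun w => a w - b w) := by
  refine (weightedNorm_sdMap_sub_le v g hg h.mul_eq_one a b).trans
    (mul_le_mul_left (add_le_add ?_ le_rfl) _)
  calc r ^ 2 * (weightedNorm r a + weightedNorm r b) ≤ r ^ 2 * (2 + 2) := by gcongr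
    _ = 4 * r ^ 2 := by ring

theorem norm_le (h : SDContraction v ε r s) (hg : ∀ j, ‖g j‖ₑ ≤ ε)
    (ha : weightedNorm r a ≤ 2) : weightedNorm r (sdMap v g a) ≤ 2 := by
  refine (weightedNorm_sdMap_le v g hg h.mul_eq_one a).trans ?_
  calc 1 + (r ^ 2 * weightedNorm r a + ε * sdLinConst v r s) * weightedNorm r a
      ≤ 1 + (r ^ 2 * 2 + ε * sdLinConst v r s) * 2 := by gcongr
    _ = 1 + (4 * r ^ 2 + 2 * (ε * sdLinConst v r s)) := by ring
    _ ≤ 1 + 1 := add_le_add le_rfl h.le_one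
    _ = 2 := one_add_one_eq_two

theorem pos (h : SDContraction v ε r s) : r ≠ 0 := by
  rintro rfl
  simpa using h.mul_eq_one

theorem ne_top (h : SDContraction v ε r s) : s ≠ ∞ := by
  rintro rfl
  have := h.mul_eq_one
  rw [ENNReal.mul_top h.pos] at this
  exact ENNReal.top_ne_one this

theorem enorm_le (h : SDContraction v ε r s) {B : ℝ≥0∞} {w : List (Fin d)}
    (hB : ‖a w‖ₑ * r ^ w.length ≤ B) : ‖a w‖ₑ ≤ B * s ^ w.length := by
  calc ‖a w‖ₑ = ‖a w‖ₑ * r ^ w.length * s ^ w.length := by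
        rw [mul_assoc, ← mul_pow, h.mul_eq_one, one_pow, mul_one]
    _ ≤ _ := mul_le_mul_left hB _

theorem unique (h : SDContraction v ε r s) (hg : ∀ j, ‖g j‖ₑ ≤ ε)
    (ha : weightedNorm r a ≤ 2) (hb : weightedNorm r b ≤ 2) (hfa : sdMap v g a = a)
    (hfb : sdMap v g b = b) : a = b := by
  have h1 := h.norm_sub_le hg ha hb
  rw [hfa, hfb] at h1
  -- In extended reals, x ≤ qx with q < 1 forces x = 0 only when x is finite.
  have hfin : weightedNorm r (fun w => a w - b w) ≠ ∞ :=
    ne_top_of_le_ne_top (by norm_num) ((weightedNorm_sub_le r a b).trans (add_le_add ha hb))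
  have h0 : weightedNorm r (fun w => a w - b w) = 0 := by
    by_contra hne
    have h2 := ENNReal.mul_lt_mul_left hne hfin h.factor_lt_one
    rw [one_mul] at h2
    exact absurd h1 (not_le.2 h2)
  ext w
  have h3 := h.enorm_le (a := fun w => a w - b w) (enorm_mul_pow_le r (fun w => a w - b w) w)
  rw [h0, zero_mul, nonpos_iff_eq_zero, enorm_eq_zero] at h3
  exact sub_eq_zero.1 h3

end SDContraction

end WeightedNorm

/-! ### Solving the Schwinger-Dyson equation -/

section Solution

open scoped ENNReal

variable {d m : ℕ}

/-- Each coordinate of the map is a polynomial in finitely many coefficients, so pointwise limits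
suffice and completeness of the weighted norm is not needed. -/
theorem continuous_sdMap_apply (v : Fin m → List (Fin d)) (g : Fin m → ℂ) (w : List (Fin d)) :
    Continuous fun a : List (Fin d) → ℂ => sdMap v g a w := by
  rcases List.eq_nil_or_concat w with rfl | ⟨p, k, rfl⟩
  · exact continuous_const
  · simp only [List.concat_eq_append, sdMap_append, sdQuad, sdLin]
    refine Continuous.sub ?_ (continuous_finsetSum _ fun j _ => continuous_const.mul ?_)
    · exact continuous_list_sum _ fun p _ => (continuous_apply p.1).mul (continuous_apply p.2)
    · exact continuous_list_sum _ fun z _ => continuous_apply (p ++ z)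

/-- The Picard iteration of the Schwinger-Dyson map. -/
def sdIter (v : Fin m → List (Fin d)) (g : Fin m → ℂ) : ℕ → List (Fin d) → ℂ
  | 0 => fun _ => 0
  | n + 1 => sdMap v g (sdIter v g n)

/-- The Picard iterates stay in the ball of radius 2 and are Cauchy at every word; by coordinatewise
continuity their limit is fixed. -/
theorem SDContraction.exists_fixed {v : Fin m → List (Fin d)} {ε r s : ℝ≥0∞} {g : Fin m → ℂ}
    (h : SDContraction v ε r s) (hg : ∀ j, ‖g j‖ₑ ≤ ε) :
    ∃ a : List (Fin d) → ℂ, sdMap v g a = a ∧ ∀ w, ‖a w‖ₑ ≤ s ^ w.length := by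
  have h2 : ∀ n, weightedNorm r (sdIter v g n) ≤ 2 := by
    intro n
    induction n with
    | zero => simp [sdIter, weightedNorm_zero]
    | succ n ih => exact h.norm_le hg ih
  set q := 4 * r ^ 2 + ε * sdLinConst v r s
  have hdiff : ∀ n, weightedNorm r (fun w => sdIter v g (n + 1) w - sdIter v g n w) ≤
      4 * q ^ n := by
    intro n
    induction n with
    | zero =>
      refine (weightedNorm_sub_le r _ _).trans ((add_le_add (h2 1) (h2 0)).trans (le_of_eq ?_))
      norm_num
    | succ n ih =>
      refine (h.norm_sub_le hg (h2 (n + 1)) (h2 n)).trans ((mul_le_mul_right ih q).trans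
        (le_of_eq ?_))
      ring
  have hcauchy : ∀ w, CauchySeq fun n => sdIter v g n w := by
    intro w
    refine cauchySeq_of_edist_le_geometric q (4 * s ^ w.length) h.factor_lt_one
      (ENNReal.mul_ne_top (by norm_num) (ENNReal.pow_ne_top h.ne_top)) fun n => ?_
    rw [edist_comm, edist_eq_enorm_sub]
    refine (h.enorm_le (a := fun w => sdIter v g (n + 1) w - sdIter v g n w)
      ((enorm_mul_pow_le r _ w).trans (hdiff n))).trans (le_of_eq ?_)
    ring
  choose a ha using fun w => cauchySeq_tendsto_of_complete (hcauchy w)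
  have hlim : Tendsto (sdIter v g) atTop (𝓝 a) := tendsto_pi_nhds.2 ha
  have hfix : sdMap v g a = a := by
    ext w
    exact tendsto_nhds_unique (((continuous_sdMap_apply v g w).tendsto a).comp hlim)
      ((ha w).comp (tendsto_add_atTop_nat 1))
  refine ⟨a, hfix, fun w => ?_⟩
  by_cases hw : w = []
  · subst hw
    rw [← hfix, sdMap_nil]
    simp
  · refine le_of_tendsto ((continuous_enorm.tendsto _).comp (ha w))
      (eventually_atTop.2 ⟨1, fun n hn => ?_⟩)
    obtain ⟨n, rfl⟩ := Nat.exists_eq_add_of_le' hn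
    have hl : w.length ≠ 0 := fun hl => hw (List.length_eq_zero_iff.1 hl)
    have h3 : (1 : ℝ≥0∞) ≤ levelNorm (sdIter v g (n + 1)) 0 := by
      refine le_trans ?_ (enorm_le_levelNorm _ [])
      simp [sdIter, sdMap_nil]
    -- From the first iterate on, the empty word accounts for 1 of the norm, which is at most 2. Any
    -- other word is left with at most 1, hence the bound s^{|w|} with constant one.
    have h4 : (1 : ℝ≥0∞) + ‖sdIter v g (n + 1) w‖ₑ * r ^ w.length ≤ 1 + 1 := by
      calc (1 : ℝ≥0∞) + ‖sdIter v g (n + 1) w‖ₑ * r ^ w.length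
          ≤ levelNorm (sdIter v g (n + 1)) 0 * r ^ 0 +
              levelNorm (sdIter v g (n + 1)) w.length * r ^ w.length := by
            rw [pow_zero, mul_one]
            exact add_le_add h3 (mul_le_mul_left (enorm_le_levelNorm _ w) _)
        _ = ∑ i ∈ {0, w.length}, levelNorm (sdIter v g (n + 1)) i * r ^ i := by
            rw [Finset.sum_pair hl.symm]
        _ ≤ weightedNorm r (sdIter v g (n + 1)) := ENNReal.sum_le_tsum _
        _ ≤ 1 + 1 := (h2 (n + 1)).trans_eq one_add_one_eq_two.symm
    have h5 := (ENNReal.add_le_add_iff_left ENNReal.one_ne_top).1 h4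
    simpa using h.enorm_le h5

theorem sdLinConst_ne_top (v : Fin m → List (Fin d)) {r s : ℝ≥0∞} (hr : r ≠ ∞) (hs : s ≠ ∞) :
    sdLinConst v r s ≠ ∞ := by
  refine ENNReal.sum_ne_top.2 fun k _ => ENNReal.sum_ne_top.2 fun j _ => ?_
  induction cyclicWords k (v j) with
  | nil => simp
  | cons z L ih =>
    simp only [List.map_cons, List.sum_cons]
    exact ENNReal.add_ne_top.2 ⟨ENNReal.mul_ne_top hr (ENNReal.pow_ne_top hs), ih⟩

/-- With r = 1/S the condition 4r² < 1 is S > 2. The linear part has a finite constant, so small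
couplings keep it within the budget (1 - 4r²)/2. -/
theorem exists_sdContraction (v : Fin m → List (Fin d)) {S : ℝ} (hS : 2 < S) :
    ∃ ε : ℝ, 0 < ε ∧ ∀ ε' ≤ ε,
      SDContraction v (ENNReal.ofReal ε') (ENNReal.ofReal S⁻¹) (ENNReal.ofReal S) := by
  have hS0 : 0 < S := by linarith
  set r := ENNReal.ofReal S⁻¹ with hr
  have hsq : 4 * r ^ 2 < 1 := by
    have h4 : (4 : ℝ≥0∞) = ENNReal.ofReal 4 := by norm_num
    rw [hr, h4, ← ENNReal.ofReal_pow (by positivity), ← ENNReal.ofReal_mul (by norm_num),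
      ENNReal.ofReal_lt_one, inv_pow, ← div_eq_mul_inv, div_lt_one (by positivity)]
    nlinarith
  have hc : (1 - 4 * r ^ 2) / 2 ≠ 0 := by
    simpa [tsub_eq_zero_iff_le] using hsq
  obtain ⟨δ, hδ, hδ'⟩ := ENNReal.exists_nnreal_pos_mul_lt
    (sdLinConst_ne_top v (ENNReal.ofReal_ne_top (r := S⁻¹)) (ENNReal.ofReal_ne_top (r := S))) hc
  refine ⟨δ, hδ, fun ε' hε' => ⟨?_, hsq, ?_⟩⟩
  · rw [hr, ← ENNReal.ofReal_mul (by positivity), inv_mul_cancel₀ hS0.ne', ENNReal.ofReal_one]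
  · have h1 : ENNReal.ofReal ε' * sdLinConst v r (ENNReal.ofReal S) ≤ (1 - 4 * r ^ 2) / 2 := by
      refine le_trans (mul_le_mul_left ?_ _) hδ'.le
      rw [← ENNReal.ofReal_coe_nnreal]
      exact ENNReal.ofReal_le_ofReal hε'
    calc 4 * r ^ 2 + 2 * (ENNReal.ofReal ε' * sdLinConst v r (ENNReal.ofReal S))
        ≤ 4 * r ^ 2 + 2 * ((1 - 4 * r ^ 2) / 2) := by gcongr
      _ = 4 * r ^ 2 + (1 - 4 * r ^ 2) := by
          rw [ENNReal.mul_div_cancel two_ne_zero ENNReal.ofNat_ne_top]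
      _ = 1 := add_tsub_cancel_of_le hsq.le

theorem enorm_le_ofReal_pow {a : List (Fin d) → ℂ} {M : ℝ} (hM : 0 ≤ M) {w : List (Fin d)} :
    ‖a w‖ₑ ≤ ENNReal.ofReal M ^ w.length ↔ ‖a w‖ ≤ M ^ w.length := by
  rw [← ENNReal.ofReal_pow hM, ← ofReal_norm, ENNReal.ofReal_le_ofReal_iff (by positivity)]

/-- The weight 1/(2M) leaves at most the geometric series of ratio 1/2, whose sum is exactly the
radius of the ball. -/
theorem weightedNorm_le_two {a : List (Fin d) → ℂ} {M : ℝ} (hM : 0 < M)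
    (h : ∀ w, ‖a w‖ ≤ M ^ w.length) : weightedNorm (ENNReal.ofReal (2 * M)⁻¹) a ≤ 2 := by
  have h1 : ∀ n, levelNorm a n * ENNReal.ofReal (2 * M)⁻¹ ^ n ≤ 2⁻¹ ^ n := by
    intro n
    have h2 : levelNorm a n ≤ ENNReal.ofReal M ^ n := by
      refine levelNorm_le fun w hw => ?_
      rw [← hw]
      exact (enorm_le_ofReal_pow hM.le).2 (h w)
    refine (mul_le_mul_left h2 _).trans (le_of_eq ?_)
    rw [← mul_pow, ← ENNReal.ofReal_mul hM.le]
    congr 1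
    rw [mul_inv, mul_left_comm, mul_inv_cancel₀ hM.ne', mul_one,
      ENNReal.ofReal_inv_of_pos two_pos]
    simp
  refine (ENNReal.tsum_le_tsum h1).trans (le_of_eq ?_)
  rw [ENNReal.tsum_geometric, ENNReal.one_sub_inv_two, inv_inv]

/-! ### Linear functionals and their moments -/

theorem cyclicDiff_potential (v : Fin m → List (Fin d)) (g : Fin m → ℂ) (i : Fin d) :
    cyclicDiff i (potential v g) =
      mono [i] + ∑ j, g j • ((cyclicWords i (v j)).map mono).sum := by
  have h1 : ∀ j : Fin d, cyclicDiff i (FreeAlgebra.ι ℂ j ^ 2) =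
      if j = i then (2 : ℂ) • mono [i] else 0 := by
    intro j
    have e : (FreeAlgebra.ι ℂ j ^ 2 : NCPoly d) = mono [j, j] := by simp [mono, sq]
    rw [e, cyclicDiff_mono]
    split_ifs with h
    · subst h
      simp [cyclicWords, splits, two_smul]
    · simp [cyclicWords, splits, h]
  simp only [potential, map_add, map_smul, map_sum, h1, cyclicDiff_mono, Finset.sum_ite_eq',
    Finset.mem_univ, if_true, smul_smul]
  norm_num

theorem tensorSq_freeDiff_mono (τ : NCPoly d →ₗ[ℂ] ℂ) (i : Fin d) (w : List (Fin d)) :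
    tensorSq τ (freeDiff i (mono w)) = sdQuad (fun w => τ (mono w)) i w := by
  rw [freeDiff_mono, map_list_sum, List.map_map, sdQuad]
  congr 1

theorem map_mono_mul_cyclicDiff (v : Fin m → List (Fin d)) (g : Fin m → ℂ)
    (τ : NCPoly d →ₗ[ℂ] ℂ) (i : Fin d) (w : List (Fin d)) :
    τ (mono w * cyclicDiff i (potential v g)) =
      τ (mono (w ++ [i])) + sdLin v g (fun w => τ (mono w)) i w := by
  rw [cyclicDiff_potential, mul_add, map_add, ← mono_append, Finset.mul_sum, map_sum, sdLin]
  congr 1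
  refine Finset.sum_congr rfl fun j _ => ?_
  rw [mul_smul_comm, map_smul, smul_eq_mul, ← List.sum_map_mul_left, map_list_sum, List.map_map]
  simp only [Function.comp_def, mono_append]

theorem linearMap_ext_mono {M : Type*} [AddCommMonoid M] [Module ℂ M]
    {σ τ : NCPoly d →ₗ[ℂ] M} (h : ∀ w, σ (mono w) = τ (mono w)) : σ = τ := by
  refine (FreeAlgebra.basisFreeMonoid ℂ (Fin d)).ext fun u => ?_
  have hu := h (FreeMonoid.toList u)
  rwa [mono_eq_basis, FreeMonoid.ofList_toList] at hu

theorem exists_linearMap_mono (a : List (Fin d) → ℂ) :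
    ∃ τ : NCPoly d →ₗ[ℂ] ℂ, ∀ w, τ (mono w) = a w := by
  refine ⟨(FreeAlgebra.basisFreeMonoid ℂ (Fin d)).constr ℂ fun w => a (FreeMonoid.toList w),
    fun w => ?_⟩
  rw [mono_eq_basis, Module.Basis.constr_basis]
  simp

/-- Monomials span, so it is enough to test P = X_w. The quadratic part of the potential isolates
the moment of wi, for which the equation is solved. -/
theorem isSchwingerDysonSolution_iff (v : Fin m → List (Fin d)) (g : Fin m → ℂ) (R : ℝ)
    (τ : NCPoly d →ₗ[ℂ] ℂ) : IsSchwingerDysonSolution (potential v g) R τ ↔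
      sdMap v g (fun w => τ (mono w)) = (fun w => τ (mono w)) ∧
        ∀ w, ‖τ (mono w)‖ ≤ R ^ w.length := by
  constructor
  · intro h
    refine ⟨?_, h.bound⟩
    ext w
    rcases List.eq_nil_or_concat w with rfl | ⟨p, k, rfl⟩
    · simpa [sdMap_nil, mono] using h.map_one.symm
    · have h1 := h.schwinger_dyson k (mono p)
      rw [tensorSq_freeDiff_mono, map_mono_mul_cyclicDiff] at h1
      rw [List.concat_eq_append, sdMap_append, h1, add_sub_cancel_right]
  · rintro ⟨h, hb⟩
    refine ⟨by simpa [sdMap_nil, mono] using (congrFun h []).symm, fun i P => ?_, hb⟩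
    have h1 : tensorSq τ ∘ₗ freeDiff i =
        τ ∘ₗ LinearMap.mulRight ℂ (cyclicDiff i (potential v g)) := by
      refine linearMap_ext_mono fun w => ?_
      have h2 := congrFun h (w ++ [i])
      rw [sdMap_append] at h2
      rw [LinearMap.comp_apply, LinearMap.comp_apply, LinearMap.mulRight_apply,
        tensorSq_freeDiff_mono, map_mono_mul_cyclicDiff, ← h2, sub_add_cancel]
    exact congrArg (fun f => f P) h1

end Solution

end PathLoop

end

/-! ### Combining existence at weight 1/R with uniqueness at weight 1/(2M) -/

open PathLoop in
theorem mainTheorem2 (d m : ℕ) (v : Fin m → List (Fin d)) (R C : ℝ) (hR : 2 < R) (hC : 0 < C) :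
    ∃ ε : ℝ, 0 < ε ∧ ∀ g : Fin m → ℂ, (∀ j, ‖g j‖ ≤ ε) →
      ∃ τ : NCPoly d →ₗ[ℂ] ℂ,
        IsSchwingerDysonSolution (potential v g) R τ ∧
        (∀ σ : NCPoly d →ₗ[ℂ] ℂ, IsSchwingerDysonSolution (potential v g) R σ → σ = τ) ∧
        ∀ (T : ℝ) [Fact (0 < T)],
          SatisfiesLoopEquation T v g (fun w => τ (mono w)) ∧
          ∀ a : List (Fin d) → ℂ, (∀ w, ‖a w‖ ≤ C ^ w.length) →
            SatisfiesLoopEquation T v g a → ∀ w, a w = τ (mono w) := by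
  have hR0 : 0 < R := by linarith
  set M := max R C
  have hRM : R ≤ M := le_max_left _ _
  have hM : 0 < M := hR0.trans_le hRM
  -- Two weights are needed: S = R yields the sharp bound R^{|w|} on the solution, while S = 2M > 2
  -- puts every competitor of growth M, for both the Schwinger-Dyson and the loop equation, into the
  -- contracted ball.
  obtain ⟨ε₁, hε₁, h₁⟩ := exists_sdContraction v hR
  obtain ⟨ε₂, hε₂, h₂⟩ := exists_sdContraction v (S := 2 * M) (by linarith)
  refine ⟨min ε₁ ε₂, lt_min hε₁ hε₂, fun g hg => ?_⟩
  have hg' : ∀ j, ‖g j‖ₑ ≤ ENNReal.ofReal (min ε₁ ε₂) := fun j => by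
    rw [← ofReal_norm]
    exact ENNReal.ofReal_le_ofReal (hg j)
  obtain ⟨a₀, hfix, hbound⟩ := (h₁ _ (min_le_left _ _)).exists_fixed hg'
  obtain ⟨τ, hτ⟩ := exists_linearMap_mono a₀
  have hτa : (fun w => τ (mono w)) = a₀ := funext hτ
  have hb₀ : ∀ w, ‖a₀ w‖ ≤ R ^ w.length := fun w => (enorm_le_ofReal_pow hR0.le).1 (hbound w)
  have huniq : ∀ b : List (Fin d) → ℂ, (∀ w, ‖b w‖ ≤ M ^ w.length) → sdMap v g b = b →
      b = a₀ := fun b hb hfb =>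
    (h₂ _ (min_le_right _ _)).unique hg' (weightedNorm_le_two hM hb)
      (weightedNorm_le_two hM fun w => (hb₀ w).trans (pow_le_pow_left₀ hR0.le hRM _)) hfb hfix
  refine ⟨τ, ?_, fun σ hσ => ?_, fun T hT => ⟨?_, fun a ha hloop w => ?_⟩⟩
  · rw [isSchwingerDysonSolution_iff, hτa]
    exact ⟨hfix, fun w => by rw [hτ]; exact hb₀ w⟩
  · obtain ⟨hσ₁, hσ₂⟩ := (isSchwingerDysonSolution_iff v g R σ).1 hσ
    have h := huniq _ (fun w => (hσ₂ w).trans (pow_le_pow_left₀ hR0.le hRM _)) hσ₁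
    exact linearMap_ext_mono fun w => (congrFun h w).trans (hτ w).symm
  · rw [hτa, satisfiesLoopEquation_iff v g (ExpBounded.of_le hR0.le hb₀)]
    exact hfix
  · rw [satisfiesLoopEquation_iff v g (ExpBounded.of_le hC.le ha)] at hloop
    rw [hτ, huniq a (fun w => (ha w).trans
      (pow_le_pow_left₀ hC.le (le_max_right _ _) _)) hloop]
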